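/- Let $q$ be an odd prime power. For a monic polynomial $f=t^n+f_{n-1}t^{n-1}+\dots+f_0\in\mathbb{F}_q[t]$ of degree $n\ge 2$ let $R(f)=\sum_{i=1}^{n-1}f_if_{i-1}$ be the Rudin–Shapiro function. Let $\mathcal{P}(n)$ be the set of monic irreducible polynomials of degree $n$ over $\mathbb{F}_q$ and, for $\gamma\in\mathbb{F}_q$, let $\mathcal{R}_n(\gamma)=\{f\in\mathcal{P}(n): R(f)=\gamma\}$. (1) There is a $\delta>0$ such that for every odd prime power $q$, every $\gamma\in\mathbb{F}_q$ and every $n\ge 3$, $$\#\mathcal{R}_n(\gamma)=\frac{\#\mathcal{P}(n)}{q}+O\left(n^{3/2}q^{(1-\delta)n+1}\right),$$ where the implied constant is absolute; one can choose $\delta=1/28$. (2) Consequently, $\#\mathcal{R}_n(\gamma)\sim \#\mathcal{P}(n)/q$, uniformly in $\gamma$, if either $n\to\infty$ or $q\to\infty$, provided $n>2/\delta=56$. That is, for every $\varepsilon>0$ there is an $N$ such that $|\#\mathcal{R}_n(\gamma)-\#\mathcal{P}(n)/q|\le\varepsilon\,\#\mathcal{P}(n)/q$ for all odd prime powers $q$,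 all $\gamma\in\mathbb{F}_q$ and all $n>56$ with $n\ge N$ or $q\ge N$. -/

import Mathlib

open Polynomial

universe u

/-- The Rudin–Shapiro function `R(f) = ∑_{i=1}^{n-1} f_i f_{i-1}`, where `n = deg f`
and `f_i` is the coefficient of `t^i` in `f`. -/
noncomputable def rudinShapiro {F : Type*} [Field F] (f : F[X]) : F :=
  ∑ i ∈ Finset.Icc 1 (f.natDegree - 1), f.coeff i * f.coeff (i - 1)

/-- The set `P(n)` of monic irreducible polynomials of degree `n` over `F`. -/
def monicIrreducibles (F : Type*) [Field F] (n : ℕ) : Set F[X] :=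
  {f | f.Monic ∧ Irreducible f ∧ f.natDegree = n}

/-- The set `R_n(γ)` of monic irreducible polynomials `f` of degree `n` with `R(f) = γ`. -/
def rudinShapiroFiber {F : Type*} [Field F] (n : ℕ) (γ : F) : Set F[X] :=
  {f | f ∈ monicIrreducibles F n ∧ rudinShapiro f = γ}

/-- Over a finite field, `P(n)` is finite, so that its `Set.ncard` is its true cardinality. -/
theorem monicIrreducibles_finite (F : Type*) [Field F] [Fintype F] (n : ℕ) :
    (monicIrreducibles F n).Finite := by
  have h : Set.InjOn (fun (f : F[X]) (i : Fin (n + 1)) => f.coeff i)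
      (monicIrreducibles F n) := by
    intro f hf g hg hfg
    ext k
    by_cases hk : k < n + 1
    · exact congrFun hfg ⟨k, hk⟩
    · rw [coeff_eq_zero_of_natDegree_lt, coeff_eq_zero_of_natDegree_lt]
      · rw [hg.2.2]; omega
      · rw [hf.2.2]; omega
  exact Set.Finite.of_finite_image (Set.toFinite _) h

/-- Over a finite field, `R_n(γ)` is finite, so that its `Set.ncard` is its true cardinality. -/
theorem rudinShapiroFiber_finite {F : Type*} [Field F] [Fintype F] (n : ℕ) (γ : F) :
    (rudinShapiroFiber n γ).Finite :=
  (monicIrreducibles_finite F n).subset fun _ hf => hf.1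

/-! ### Autocorrelation as a Laurent polynomial coefficient, and triangular linear systems -/

section LaurentAlgebra
open LaurentPolynomial

variable {F : Type*} [Field F]

/-! Write `N(f) = f(T) f(1/T)`. For monic `f` of positive degree, `R(f)` is the coefficient of
`N(f)` at `1` minus the next-to-leading coefficient of `f`. Since `N` is multiplicative and the
next-to-leading coefficient is additive on products of monic polynomials, `R(dg)` is a quadratic
polynomial in the coefficients of `d` whose quadratic part depends on `g` only through `N(g)`. By
orthogonality of additive characters it suffices to bound `∑ ψ(R(f))` over irreducible `f` for
nontrivial `ψ`. Vaughan's identity (`polyMangoldt_eq_vaughan`) with cut-off `u = (n-1)/3` reduces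
this to two kinds of sums.

Type I (`norm_sum_rudinShapiro_mul_sq_le`): one factor `a` is fixed, of degree `D ≤ u`, the other is
free of degree `m`. Differencing bounds the squared sum by `q^m` times the number of `e` of degree
below `m` for which `(T + 1/T) N(a) e` has vanishing coefficients at `0, …, m-1`. This system is
triangular with band half-width `D + 1`, so there are at most `q^(D+1)` such `e`.

Type II (`norm_bilinear_rudinShapiro_pow_four_le`): both factors have degree above `u`. Two
applications of Cauchy–Schwarz remove the weights. Differencing in the factor of smaller degree `k`
then leaves a count of triples `(e, g, g')` for which `(T + 1/T) e (N(g) - N(g'))` vanishes at `0,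
…, k-1`. For `e ≠ 0` this determines `k/2` of the `m + 1` free coefficients of the symmetric Laurent
polynomial `N(g) - N(g')`. Each value of this difference occurs at most `(m+1)^3 q^m` times, because
`N(g) = N(g')` forces `g'` to divide `g` times its reversal, and the divisor function has a small
second moment.

With `k > u` the fourth power of a type II sum gains about `q^(n/6)`, which yields an error of
`q^(23n/24 + 3/8)` up to powers of `n`. As `23/24 < 27/28`, the powers of `n` are absorbed. -/

theorem laurent_coeff_mul_eq_single (f g : F[T;T⁻¹]) (n j : ℤ)
    (h : ∀ l, f.coeff l ≠ 0 → l ≠ n - j → g.coeff (n - l) = 0) :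
    (f * g).coeff n = f.coeff (n - j) * g.coeff j := by
  rw [AddMonoidAlgebra.coeff_mul_apply_left, Finsupp.sum, Finset.sum_eq_single (n - j)]
  · congr 2; ring
  · intro l hl hne
    rw [show -l + n = n - l by ring, h l (by simpa using hl) hne, mul_zero]
  · intro hl
    rw [Finsupp.notMem_support_iff.1 hl, zero_mul]

theorem laurent_coeff_T_mul (f : F[T;T⁻¹]) (m n : ℤ) :
    (T m * f).coeff n = f.coeff (n - m) := by
  rw [T, AddMonoidAlgebra.coeff_single_mul_apply, one_mul]
  congr 1; ring

theorem coeff_toLaurent_natCast (f : F[X]) (i : ℕ) : (toLaurent f).coeff (i : ℤ) = f.coeff i := by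
  rw [coeff_toLaurent]
  exact Finsupp.mapDomain_apply Nat.castEmbedding.injective _ _

theorem coeff_toLaurent_of_neg (f : F[X]) {i : ℤ} (hi : i < 0) : (toLaurent f).coeff i = 0 := by
  rw [coeff_toLaurent]
  refine Finsupp.mapDomain_of_notMem_range _ _ ?_
  rintro ⟨j, rfl⟩
  simp at hi
  omega

theorem coeff_toLaurent_of_natDegree_lt (f : F[X]) {i : ℤ} (hi : (f.natDegree : ℤ) < i) :
    (toLaurent f).coeff i = 0 := by
  lift i to ℕ using by omega
  rw [coeff_toLaurent_natCast]
  exact coeff_eq_zero_of_natDegree_lt (by omega)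

theorem toLaurent_mul_coeff (f : F[X]) (g : F[T;T⁻¹]) (n : ℤ) :
    (toLaurent f * g).coeff n =
      ∑ i ∈ Finset.range (f.natDegree + 1), f.coeff i * g.coeff (n - i) := by
  conv_lhs => rw [f.as_sum_range_C_mul_X_pow]
  rw [map_sum, Finset.sum_mul, AddMonoidAlgebra.coeff_sum, Finsupp.finsetSum_apply]
  refine Finset.sum_congr rfl fun i _ => ?_
  rw [toLaurent_C_mul_X_pow, mul_assoc, ← LaurentPolynomial.smul_eq_C_mul, AddMonoidAlgebra.coeff_smul_apply,
    laurent_coeff_T_mul, smul_eq_mul]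

/-- The sum `∑ f_i f_{i+1}` over all pairs of consecutive coefficients. -/
noncomputable def autocorr (f : F[X]) : F :=
  (toLaurent f * invert (toLaurent f)).coeff 1

/-- The sum of the coefficients at `1` and `-1`. -/
noncomputable def shiftSum : F[T;T⁻¹] →ₗ[F] F where
  toFun W := W.coeff 1 + W.coeff (-1)
  map_add' x y := by simp only [AddMonoidAlgebra.coeff_add, Finsupp.add_apply]; ring
  map_smul' c x := by
    simp only [AddMonoidAlgebra.coeff_smul_apply, smul_eq_mul, RingHom.id_apply]; ring

theorem shiftSum_apply (W : F[T;T⁻¹]) : shiftSum W = W.coeff 1 + W.coeff (-1) := rfl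

/-- Polarisation: the second cross term is the image of the first under `T ↦ 1/T`, so its
coefficient at `1` is that of the first at `-1`. -/
theorem autocorr_add (x y : F[X]) : autocorr (x + y) =
    autocorr x + autocorr y + shiftSum (toLaurent x * invert (toLaurent y)) := by
  have h : (toLaurent x * invert (toLaurent y)).coeff (-1)
      = (toLaurent y * invert (toLaurent x)).coeff 1 := by
    rw [← invert_apply, map_mul, involutive_invert (toLaurent y), mul_comm]
  rw [shiftSum_apply, h, autocorr, autocorr, autocorr, map_add, map_add]
  simp only [add_mul, mul_add, AddMonoidAlgebra.coeff_add, Finsupp.add_apply]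
  ring

/-- The autocorrelation has one extra pair, the leading coefficient `1` with its neighbour.
Including it gains multiplicativity in `f`, at the cost of a linear correction. -/
theorem rudinShapiro_eq_autocorr_sub {f : F[X]} (hf : f.Monic) (hd : 1 ≤ f.natDegree) :
    rudinShapiro f = autocorr f - f.nextCoeff := by
  rw [autocorr, toLaurent_mul_coeff, rudinShapiro, nextCoeff_of_natDegree_pos hd,
    Finset.sum_range_succ]
  obtain ⟨n, hn⟩ : ∃ n, f.natDegree = n + 1 := ⟨f.natDegree - 1, by omega⟩
  have h1 : f.coeff (n + 1) = 1 := by rw [← hn]; exact hf.coeff_natDegree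
  have key : ∀ i : ℕ, (invert (toLaurent f)).coeff ((1 : ℤ) - ((i + 1 : ℕ) : ℤ)) = f.coeff i := by
    intro i
    rw [invert_apply, show -((1 : ℤ) - ((i + 1 : ℕ) : ℤ)) = (i : ℤ) by push_cast; ring,
      coeff_toLaurent_natCast]
  have key0 : (invert (toLaurent f)).coeff ((1 : ℤ) - ((0 : ℕ) : ℤ)) = 0 := by
    rw [invert_apply]; exact coeff_toLaurent_of_neg _ (by norm_num)
  rw [hn, key n, h1, Finset.sum_range_succ', key0]
  simp only [key, mul_zero, add_zero, Nat.add_sub_cancel, one_mul, add_sub_cancel_right]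
  rw [← Finset.Ico_add_one_right_eq_Icc, ← zero_add 1, ← Finset.sum_Ico_add', ← Finset.range_eq_Ico]
  simp

/-- Multiplication by this polynomial adds the two neighbouring coefficients. -/
noncomputable def neighbourSum (F : Type*) [Field F] : F[T;T⁻¹] := T 1 + T (-1)

theorem invert_neighbourSum : invert (neighbourSum F) = neighbourSum F := by
  simp [neighbourSum, add_comm]

theorem neighbourSum_mul_coeff (W : F[T;T⁻¹]) (n : ℤ) :
    (neighbourSum F * W).coeff n = W.coeff (n - 1) + W.coeff (n + 1) := by
  rw [neighbourSum, add_mul, AddMonoidAlgebra.coeff_add, Finsupp.add_apply, laurent_coeff_T_mul,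
    laurent_coeff_T_mul, sub_neg_eq_add]

theorem neighbourSum_ne_zero : neighbourSum F ≠ 0 := by
  intro h
  have := congrArg (fun W : F[T;T⁻¹] => W.coeff 1) h
  simp [neighbourSum] at this

/-- Testing the functional on the monomials `X ^ i` turns its vanishing into consecutive vanishing
coefficients of one product. -/
theorem coeff_eq_zero_of_shiftSum_eq_zero {k : ℕ} {W : F[T;T⁻¹]}
    (h : ∀ x ∈ degreeLT F k, shiftSum (toLaurent x * W) = 0) {i : ℕ} (hi : i < k) :
    (neighbourSum F * invert W).coeff i = 0 := by
  have h1 := h (X ^ i) (by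
    rw [mem_degreeLT, degree_X_pow]; exact_mod_cast hi)
  rw [shiftSum_apply, toLaurent_X_pow, laurent_coeff_T_mul, laurent_coeff_T_mul] at h1
  rw [neighbourSum_mul_coeff, invert_apply, invert_apply, ← h1]
  congr 2 <;> ring

theorem exists_min_coeff {A : F[T;T⁻¹]} (hA : A ≠ 0) :
    ∃ ρ, A.coeff ρ ≠ 0 ∧ ∀ l, A.coeff l ≠ 0 → ρ ≤ l := by
  have hne : A.coeff.support.Nonempty := by
    rw [Finsupp.support_nonempty_iff]
    simpa using hA
  exact ⟨_, Finsupp.mem_support_iff.1 (A.coeff.support.min'_mem hne),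
    fun l hl => Finset.min'_le _ _ (Finsupp.mem_support_iff.2 hl)⟩

theorem exists_max_coeff {A : F[T;T⁻¹]} (hA : A ≠ 0) :
    ∃ σ, A.coeff σ ≠ 0 ∧ ∀ l, A.coeff l ≠ 0 → l ≤ σ := by
  obtain ⟨ρ, h1, h2⟩ := exists_min_coeff (A := invert A) (by simpa using hA)
  refine ⟨-ρ, by simpa using h1, fun l hl => ?_⟩
  have := h2 (-l) (by simpa using hl)
  omega

/-- A banded Toeplitz system has a kernel of dimension at most half of the band width. -/
theorem eq_zero_of_symm_mul_coeff_eq_zero {A : F[T;T⁻¹]} (hA : A ≠ 0) (hs : invert A = A) {D m : ℕ}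
    (hD : ∀ l : ℤ, A.coeff l ≠ 0 → -(D : ℤ) ≤ l) {h : F[X]} (hh : h ∈ degreeLT F m)
    (hz : ∀ i < m, (A * toLaurent h).coeff i = 0) (h0 : ∀ j < D, h.coeff j = 0) : h = 0 := by
  obtain ⟨ρ, h1, h2⟩ := exists_min_coeff hA
  -- Symmetry enters only here: with `ρ ≤ 0`, the equation at `j + ρ` that determines `h_j` has
  -- index below `m`.
  have hρ : ρ ≤ 0 := by
    have := h2 (-ρ) (by rwa [← invert_apply, hs])
    omega
  have hρD := hD ρ h1
  ext j
  rw [coeff_zero]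
  induction j using Nat.strong_induction_on with
  | _ j ih =>
    by_cases hj : j < D
    · exact h0 j hj
    by_cases hm : m ≤ j
    · rw [mem_degreeLT] at hh
      exact coeff_eq_zero_of_degree_lt (hh.trans_le (by exact_mod_cast hm))
    -- In the equation at `j + ρ`, the lowest term of `A` meets `h_j` and all other terms meet
    -- earlier coefficients. Since `j ≥ D ≥ -ρ`, this index is nonnegative.
    obtain ⟨i, hi⟩ : ∃ i : ℕ, (i : ℤ) = j + ρ := ⟨(j + ρ).toNat, by omega⟩
    have h3 := hz i (by omega)
    rw [laurent_coeff_mul_eq_single _ _ _ (j : ℤ), coeff_toLaurent_natCast] at h3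
    · refine (mul_eq_zero.1 h3).resolve_left ?_
      rwa [hi, show (j : ℤ) + ρ - j = ρ by ring]
    · intro l hl hne
      have := h2 l hl
      rcases lt_or_ge ((i : ℤ) - l) 0 with hneg | hnn
      · exact coeff_toLaurent_of_neg _ hneg
      · obtain ⟨s, hs⟩ : ∃ s : ℕ, (s : ℤ) = i - l := ⟨((i : ℤ) - l).toNat, by omega⟩
        rw [← hs, coeff_toLaurent_natCast]
        exact ih s (by omega)

/-- A symmetric Laurent polynomial is determined by few of its coefficients, if sufficiently many
coefficients of a multiple of it are given. -/
theorem exists_finset_determining_symm {E : F[T;T⁻¹]} (hE : E ≠ 0) {k m : ℕ} (hkm : k ≤ m)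
    (hlo : ∀ l : ℤ, E.coeff l ≠ 0 → -1 ≤ l) (hhi : ∀ l : ℤ, E.coeff l ≠ 0 → l ≤ k) :
    ∃ J : Finset ℤ, J.card = m + 1 - k / 2 ∧ ∀ Z : F[T;T⁻¹], invert Z = Z →
      (∀ j : ℤ, m < j → Z.coeff j = 0) → (∀ i < k, (E * Z).coeff (i : ℤ) = 0) →
      (∀ j ∈ J, Z.coeff j = 0) → Z = 0 := by
  obtain ⟨ρ, hρ, hρ'⟩ := exists_min_coeff hE
  obtain ⟨σ, hσ, hσ'⟩ := exists_max_coeff hE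
  have b1 := hlo ρ hρ
  have b2 := hhi σ hσ
  have b3 := hρ' σ hσ
  -- It suffices to find a window of `k / 2` consecutive indices at which `Z_j` is forced by the
  -- earlier `Z_0, …, Z_{j-1}`. The set `J` is then the complement of the window in `[0, m]`.
  suffices H : ∃ s : ℤ, 1 ≤ s ∧ s + (k / 2 : ℕ) ≤ m + 1 ∧ ∀ Z : F[T;T⁻¹], invert Z = Z →
      (∀ i < k, (E * Z).coeff (i : ℤ) = 0) → ∀ j : ℕ, s ≤ j → j < s + (k / 2 : ℕ) →
      (∀ j' < j, Z.coeff (j' : ℤ) = 0) → Z.coeff (j : ℤ) = 0 by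
    obtain ⟨s, hs1, hs2, H⟩ := H
    refine ⟨Finset.Icc 0 (m : ℤ) \ Finset.Ico s (s + (k / 2 : ℕ)), ?_, ?_⟩
    · rw [Finset.card_sdiff_of_subset, Int.card_Icc, Int.card_Ico]
      · omega
      · intro x hx
        simp only [Finset.mem_Ico, Finset.mem_Icc] at hx ⊢
        omega
    · intro Z hsymm hm hEZ hJ
      have key : ∀ j : ℕ, Z.coeff (j : ℤ) = 0 := by
        intro j
        induction j using Nat.strong_induction_on with
        | _ j ih =>
          by_cases hj : (j : ℤ) ∈ Finset.Icc 0 (m : ℤ) \ Finset.Ico s (s + (k / 2 : ℕ))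
          · exact hJ _ hj
          simp only [Finset.mem_sdiff, Finset.mem_Icc, Finset.mem_Ico] at hj
          by_cases hjm : (m : ℤ) < j
          · exact hm _ hjm
          exact H Z hsymm hEZ j (by omega) (by omega) ih
      refine LaurentPolynomial.ext fun a => ?_
      rcases Int.eq_nat_or_neg a with ⟨n, rfl | rfl⟩
      · simpa using key n
      · rw [← invert_apply, hsymm]; simpa using key n
  have habs : ∀ Z : F[T;T⁻¹], invert Z = Z → ∀ j : ℕ, (∀ j' < j, Z.coeff (j' : ℤ) = 0) →
      ∀ a : ℤ, -j < a → a < j → Z.coeff a = 0 := by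
    intro Z hsymm j hj a ha1 ha2
    rcases Int.eq_nat_or_neg a with ⟨n, rfl | rfl⟩
    · exact hj n (by omega)
    · rw [← invert_apply, hsymm]; exact hj n (by omega)
  -- The coefficient `Z_j` can be isolated by the lowest term of `E`, at index `j + ρ`, or as
  -- `Z_{-j}` by the highest term, at index `σ - j`. Either way the other indices lie strictly
  -- between `-j` and `j` as soon as `2j > σ - ρ`. The sign of `ρ + σ - k` decides which choice has
  -- `k / 2` admissible equations with index in `[0, k)`.
  rcases lt_or_ge (ρ + σ) (k : ℤ) with hlt | hge
  · refine ⟨k - (k / 2 : ℕ) - ρ, by omega, by omega, fun Z hsymm hEZ j hj1 hj2 hj => ?_⟩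
    obtain ⟨i, hi⟩ : ∃ i : ℕ, (i : ℤ) = j + ρ := ⟨(j + ρ).toNat, by omega⟩
    have h3 := hEZ i (by omega)
    rw [laurent_coeff_mul_eq_single _ _ _ (j : ℤ)] at h3
    · refine (mul_eq_zero.1 h3).resolve_left ?_
      rwa [hi, show (j : ℤ) + ρ - j = ρ by ring]
    · intro l hl hne
      have := hρ' l hl
      have := hσ' l hl
      exact habs Z hsymm j hj _ (by omega) (by omega)
  · refine ⟨σ - (k / 2 : ℕ) + 1, by omega, by omega, fun Z hsymm hEZ j hj1 hj2 hj => ?_⟩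
    obtain ⟨i, hi⟩ : ∃ i : ℕ, (i : ℤ) = σ - j := ⟨(σ - j).toNat, by omega⟩
    have h3 := hEZ i (by omega)
    rw [laurent_coeff_mul_eq_single _ _ _ (-j : ℤ), ← invert_apply, hsymm] at h3
    · refine (mul_eq_zero.1 h3).resolve_left ?_
      rwa [hi, show σ - (j : ℤ) - -j = σ by ring]
    · intro l hl hne
      have := hρ' l hl
      have := hσ' l hl
      exact habs Z hsymm j hj _ (by omega) (by omega)

end LaurentAlgebra

/-! ### Parametrisation of monic polynomials, and reversal -/

section LowDegree

variable {F : Type*} [Field F]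

theorem degree_lt_of_mem_degreeLT {n : ℕ} (x : degreeLT F n) : (x : F[X]).degree < n :=
  mem_degreeLT.1 x.2

theorem monic_X_pow_add_degreeLT {n : ℕ} (x : degreeLT F n) : (X ^ n + (x : F[X])).Monic :=
  monic_X_pow_add (degree_lt_of_mem_degreeLT x)

theorem natDegree_X_pow_add_degreeLT {n : ℕ} (x : degreeLT F n) :
    (X ^ n + (x : F[X])).natDegree = n := by
  apply natDegree_eq_of_degree_eq_some
  rw [degree_add_eq_left_of_degree_lt, degree_X_pow]
  rw [degree_X_pow]
  exact degree_lt_of_mem_degreeLT x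

theorem sub_X_pow_mem_degreeLT {n : ℕ} {f : F[X]} (hf : f.Monic) (hn : f.natDegree = n) :
    f - X ^ n ∈ degreeLT F n := by
  rw [mem_degreeLT]
  have h1 : f.degree = n := by rw [degree_eq_natDegree hf.ne_zero, hn]
  rw [← h1]
  apply degree_sub_lt_left
  · rw [degree_X_pow, h1]
  · exact hf.ne_zero
  · rw [hf.leadingCoeff, (monic_X_pow n).leadingCoeff]

theorem reverse_reverse_of_coeff_zero_ne_zero {h : F[X]} (h0 : h.coeff 0 ≠ 0) :
    h.reverse.reverse = h := by
  have hnd : h.natTrailingDegree = 0 := natTrailingDegree_eq_zero.2 (Or.inr h0)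
  have h1 : h.reverse.natDegree = h.natDegree := by rw [reverse_natDegree, hnd]; rfl
  rw [reverse, h1, reverse, reflect_reflect]

/-- Reversal discards exactly the power of `X` in `g`; on the cofactor it is an involution. -/
theorem reverse_reverse_dvd (g : F[X]) : g.reverse.reverse ∣ g := by
  by_cases hg : g = 0
  · simp [hg]
  obtain ⟨h, hh, hX⟩ := exists_eq_pow_rootMultiplicity_mul_and_not_dvd g hg 0
  rw [C_0, sub_zero] at hh hX
  have h0 : h.coeff 0 ≠ 0 := fun h0 => hX (X_dvd_iff.2 h0)
  rw [hh, reverse_X_pow_mul]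
  rw [reverse_reverse_of_coeff_zero_ne_zero h0]
  exact dvd_mul_left _ _

end LowDegree

/-! ### Monic polynomials, factorisations and moments of the divisor function -/

section MonicPolynomials

variable (F : Type*) [Field F] [Fintype F]

instance degreeLT_finite (n : ℕ) : Finite (degreeLT F n) :=
  Finite.of_equiv _ (degreeLTEquiv F n).symm.toEquiv

noncomputable instance degreeLT_fintype (n : ℕ) : Fintype (degreeLT F n) := Fintype.ofFinite _

theorem card_degreeLT (n : ℕ) : Fintype.card (degreeLT F n) = Fintype.card F ^ n := by
  rw [Fintype.card_congr (degreeLTEquiv F n).toEquiv]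
  simp

variable {F}

open Classical in
variable (F) in
/-- The monic polynomials of degree `n`. -/
noncomputable def monics (n : ℕ) : Finset F[X] :=
  Finset.univ.image fun x : degreeLT F n => X ^ n + (x : F[X])

theorem mem_monics {n : ℕ} {f : F[X]} : f ∈ monics F n ↔ f.Monic ∧ f.natDegree = n := by
  simp only [monics, Finset.mem_image, Finset.mem_univ, true_and]
  constructor
  · rintro ⟨x, rfl⟩
    exact ⟨monic_X_pow_add_degreeLT x, natDegree_X_pow_add_degreeLT x⟩
  · rintro ⟨hf, hn⟩
    exact ⟨⟨f - X ^ n, sub_X_pow_mem_degreeLT hf hn⟩, by simp⟩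

theorem sum_monics {M : Type*} [AddCommMonoid M] (n : ℕ) (φ : F[X] → M) :
    ∑ f ∈ monics F n, φ f = ∑ x : degreeLT F n, φ (X ^ n + (x : F[X])) := by
  classical
  rw [monics, Finset.sum_image]
  intro x _ y _ hxy
  exact Subtype.ext (add_left_cancel hxy)

theorem card_monics (n : ℕ) : (monics F n).card = Fintype.card F ^ n := by
  rw [Finset.card_eq_sum_ones, sum_monics, ← card_degreeLT]
  simp

open Classical in
/-- The monic divisors of a non-zero polynomial. -/
noncomputable def monicDivisors (f : F[X]) : Finset F[X] :=
  ((Finset.range (f.natDegree + 1)).biUnion (monics F)).filter (· ∣ f)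

theorem mem_monicDivisors {f d : F[X]} (hf : f ≠ 0) : d ∈ monicDivisors f ↔ d.Monic ∧ d ∣ f := by
  simp only [monicDivisors, Finset.mem_filter, Finset.mem_biUnion, Finset.mem_range, mem_monics]
  constructor
  · rintro ⟨⟨_, _, h, _⟩, h'⟩
    exact ⟨h, h'⟩
  · rintro ⟨h, h'⟩
    exact ⟨⟨_, Nat.lt_succ_of_le (natDegree_le_of_dvd h' hf), h, rfl⟩, h'⟩

open Classical in
/-- The pairs of monic polynomials with a given monic product. -/
noncomputable def factorPairs (f : F[X]) : Finset (F[X] × F[X]) :=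
  (monicDivisors f ×ˢ monicDivisors f).filter fun p => p.1 * p.2 = f

theorem mem_factorPairs {f : F[X]} (hf : f.Monic) {p : F[X] × F[X]} :
    p ∈ factorPairs f ↔ p.1.Monic ∧ p.2.Monic ∧ p.1 * p.2 = f := by
  simp only [factorPairs, Finset.mem_filter, Finset.mem_product, mem_monicDivisors hf.ne_zero]
  constructor
  · rintro ⟨⟨⟨h1, _⟩, h2, _⟩, h3⟩
    exact ⟨h1, h2, h3⟩
  · rintro ⟨h1, h2, h3⟩
    exact ⟨⟨⟨h1, h3 ▸ dvd_mul_right _ _⟩, h2, h3 ▸ dvd_mul_left _ _⟩, h3⟩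

theorem natDegree_add_of_mem_factorPairs {f : F[X]} (hf : f.Monic) {p : F[X] × F[X]}
    (hp : p ∈ factorPairs f) : p.1.natDegree + p.2.natDegree = f.natDegree := by
  obtain ⟨h1, h2, h3⟩ := (mem_factorPairs hf).1 hp
  rw [← h3, h1.natDegree_mul h2]

theorem sum_factorPairs_fst {M : Type*} [AddCommMonoid M] {f : F[X]} (hf : f.Monic)
    (φ : F[X] → M) : ∑ p ∈ factorPairs f, φ p.1 = ∑ d ∈ monicDivisors f, φ d := by
  refine Finset.sum_nbij Prod.fst ?_ ?_ ?_ fun _ _ => rfl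
  · intro p hp
    obtain ⟨h1, h2, h3⟩ := (mem_factorPairs hf).1 hp
    exact (mem_monicDivisors hf.ne_zero).2 ⟨h1, h3 ▸ dvd_mul_right _ _⟩
  · intro p hp p' hp' h
    obtain ⟨h1, h2, h3⟩ := (mem_factorPairs hf).1 hp
    obtain ⟨h1', h2', h3'⟩ := (mem_factorPairs hf).1 hp'
    refine Prod.ext h (mul_left_cancel₀ h1.ne_zero ?_)
    rw [h3, h, h3']
  · intro d hd
    obtain ⟨h1, e, h2⟩ := (mem_monicDivisors hf.ne_zero).1 hd
    refine ⟨(d, e), (mem_factorPairs hf).2 ⟨h1, ?_, h2.symm⟩, rfl⟩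
    exact h1.of_mul_monic_left (h2 ▸ hf)

theorem card_factorPairs {f : F[X]} (hf : f.Monic) :
    (factorPairs f).card = (monicDivisors f).card := by
  rw [Finset.card_eq_sum_ones, Finset.card_eq_sum_ones]
  exact sum_factorPairs_fst hf fun _ => 1

theorem sum_monics_sum_factorPairs {M : Type*} [AddCommMonoid M] (n : ℕ) (φ : F[X] → F[X] → M) :
    ∑ f ∈ monics F n, ∑ p ∈ factorPairs f, φ p.1 p.2 =
      ∑ k ∈ Finset.range (n + 1), ∑ a ∈ monics F k, ∑ b ∈ monics F (n - k), φ a b := by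
  simp only [← Finset.sum_product']
  rw [Finset.sum_sigma', Finset.sum_sigma']
  refine Finset.sum_nbij' (fun s => ⟨s.2.1.natDegree, s.2⟩) (fun s => ⟨s.2.1 * s.2.2, s.2⟩)
    ?_ ?_ ?_ ?_ ?_
  · rintro ⟨f, p⟩ h
    simp only [Finset.mem_sigma, mem_monics] at h
    have h1 := (mem_factorPairs h.1.1).1 h.2
    have h2 := natDegree_add_of_mem_factorPairs h.1.1 h.2
    simp only [Finset.mem_sigma, Finset.mem_range, Finset.mem_product, mem_monics]
    exact ⟨by omega, ⟨h1.1, trivial⟩, h1.2.1, by omega⟩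
  · rintro ⟨k, p⟩ h
    simp only [Finset.mem_sigma, Finset.mem_range, Finset.mem_product, mem_monics] at h
    obtain ⟨h1, ⟨h2, h3⟩, h4, h5⟩ := h
    simp only [Finset.mem_sigma, mem_monics]
    exact ⟨⟨h2.mul h4, by rw [h2.natDegree_mul h4]; omega⟩,
      (mem_factorPairs (h2.mul h4)).2 ⟨h2, h4, rfl⟩⟩
  · rintro ⟨f, p⟩ h
    simp only [Finset.mem_sigma, mem_monics] at h
    obtain ⟨h1, h2, h3⟩ := (mem_factorPairs h.1.1).1 h.2
    simp [h3]
  · rintro ⟨k, p⟩ h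
    simp only [Finset.mem_sigma, Finset.mem_range, Finset.mem_product, mem_monics] at h
    simp [h.2.1.2]
  · rintro ⟨f, p⟩ h
    rfl

/-- Every divisor of `a * b` is a divisor of `a` times a divisor of `b`, by unique factorisation. -/
theorem card_monicDivisors_mul_le {a b : F[X]} (ha : a ≠ 0) (hb : b ≠ 0) :
    (monicDivisors (a * b)).card ≤ (monicDivisors a).card * (monicDivisors b).card := by
  classical
  rw [← Finset.card_product]
  refine (Finset.card_le_card fun d hd => ?_).trans
    (Finset.card_image_le (f := fun p : F[X] × F[X] => p.1 * p.2))
  obtain ⟨h1, h2⟩ := (mem_monicDivisors (mul_ne_zero ha hb)).1 hd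
  obtain ⟨d₁, d₂, h3, h4, rfl⟩ := exists_dvd_and_dvd_of_dvd_mul h2
  have hne := mul_ne_zero_iff.1 h1.ne_zero
  refine Finset.mem_image.2 ⟨(normalize d₁, normalize d₂), Finset.mem_product.2 ⟨?_, ?_⟩, ?_⟩
  · exact (mem_monicDivisors ha).2 ⟨monic_normalize hne.1, normalize_dvd_iff.2 h3⟩
  · exact (mem_monicDivisors hb).2 ⟨monic_normalize hne.2, normalize_dvd_iff.2 h4⟩
  · exact eq_of_monic_of_associated ((monic_normalize hne.1).mul (monic_normalize hne.2)) h1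
      ((normalize_associated d₁).mul_mul (normalize_associated d₂))

theorem sum_card_monicDivisors (n : ℕ) :
    ∑ f ∈ monics F n, (monicDivisors f).card = (n + 1) * Fintype.card F ^ n := by
  have h : ∀ f ∈ monics F n, (monicDivisors f).card = ∑ p ∈ factorPairs f, 1 := by
    intro f hf
    rw [← card_factorPairs (mem_monics.1 hf).1, Finset.card_eq_sum_ones]
  rw [Finset.sum_congr rfl h, sum_monics_sum_factorPairs n fun _ _ => 1]
  have h2 : ∀ k ∈ Finset.range (n + 1),
      ∑ a ∈ monics F k, ∑ b ∈ monics F (n - k), 1 = Fintype.card F ^ n := by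
    intro k hk
    simp only [Finset.sum_const, card_monics, smul_eq_mul, mul_one]
    rw [← pow_add]
    congr 1
    simp at hk
    omega
  rw [Finset.sum_congr rfl h2]
  simp

/-- With `τ` the divisor function, `τ(f)^2 = ∑_{ab=f} τ(ab) ≤ ∑_{ab=f} τ(a)τ(b)`. Summing over `f`
decouples `a` and `b` and leaves first moments. -/
theorem sum_card_monicDivisors_sq_le (n : ℕ) :
    ∑ f ∈ monics F n, (monicDivisors f).card ^ 2 ≤ (n + 1) ^ 3 * Fintype.card F ^ n := by
  have h : ∀ f ∈ monics F n, (monicDivisors f).card ^ 2 ≤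
      ∑ p ∈ factorPairs f, (monicDivisors p.1).card * (monicDivisors p.2).card := by
    intro f hf
    have hf := (mem_monics.1 hf).1
    rw [sq]
    nth_rewrite 1 [← card_factorPairs hf]
    rw [← smul_eq_mul]
    refine Finset.card_nsmul_le_sum _ _ _ fun p hp => ?_
    obtain ⟨h1, h2, h3⟩ := (mem_factorPairs hf).1 hp
    rw [← h3]
    exact card_monicDivisors_mul_le h1.ne_zero h2.ne_zero
  refine (Finset.sum_le_sum h).trans ?_
  rw [sum_monics_sum_factorPairs n fun a b => (monicDivisors a).card * (monicDivisors b).card]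
  have h2 : ∀ k ∈ Finset.range (n + 1), ∑ a ∈ monics F k, ∑ b ∈ monics F (n - k),
      (monicDivisors a).card * (monicDivisors b).card ≤ (n + 1) ^ 2 * Fintype.card F ^ n := by
    intro k hk
    rw [Finset.mem_range] at hk
    rw [← Finset.sum_mul_sum, sum_card_monicDivisors, sum_card_monicDivisors,
      mul_mul_mul_comm, ← pow_add, show k + (n - k) = n by omega, sq]
    gcongr <;> omega
  refine (Finset.sum_le_sum h2).trans ?_
  rw [Finset.sum_const, Finset.card_range, smul_eq_mul]
  apply le_of_eq; ring

/-- The constant term of `g.reverse` is the leading coefficient of `g`, so no divisor of it is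
divisible by `X`. On such divisors reversal is injective up to units, with images dividing `g`. -/
theorem card_monicDivisors_reverse_le {g : F[X]} (hg : g ≠ 0) :
    (monicDivisors g.reverse).card ≤ (monicDivisors g).card := by
  classical
  have hg' : g.reverse ≠ 0 := by simpa using hg
  have hc : ∀ d ∈ monicDivisors g.reverse, d.coeff 0 ≠ 0 := by
    intro d hd h0
    obtain ⟨h1, e, h2⟩ := (mem_monicDivisors hg').1 hd
    have h3 := congrArg (fun f : F[X] => f.coeff 0) h2
    simp only [coeff_zero_reverse, mul_coeff_zero, h0, zero_mul, leadingCoeff_eq_zero] at h3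
    exact hg h3
  refine Finset.card_le_card_of_injOn (fun d => normalize d.reverse) ?_ ?_
  · intro d hd
    obtain ⟨h1, e, h2⟩ := (mem_monicDivisors hg').1 hd
    refine (mem_monicDivisors hg).2 ⟨monic_normalize (by simpa using h1.ne_zero), ?_⟩
    rw [normalize_dvd_iff]
    refine dvd_trans ?_ (reverse_reverse_dvd g)
    rw [h2, reverse_mul_of_domain]
    exact dvd_mul_right _ _
  · intro d hd d' hd' h
    have hm := ((mem_monicDivisors hg').1 hd).1
    have hm' := ((mem_monicDivisors hg').1 hd').1
    have h1 : Associated d.reverse d'.reverse := normalize_eq_normalize_iff_associated.1 h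
    have hdvd : ∀ {a b : F[X]}, a ∣ b → a.reverse ∣ b.reverse := by
      rintro a _ ⟨c, rfl⟩
      rw [reverse_mul_of_domain]
      exact dvd_mul_right _ _
    have h2 := hdvd h1.dvd
    have h3 := hdvd h1.symm.dvd
    rw [reverse_reverse_of_coeff_zero_ne_zero (hc d hd),
      reverse_reverse_of_coeff_zero_ne_zero (hc d' hd')] at h2 h3
    exact eq_of_monic_of_associated hm hm' (associated_of_dvd_dvd h2 h3)

open LaurentPolynomial in
open Classical in
-- Multiplying by `T^m` turns the equation into `g * g.reverse = d * d.reverse`. Given `g`, there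
-- are thus at most `τ(g * g.reverse) ≤ τ(g)^2` choices of `d`.
theorem card_eq_toLaurent_mul_invert_le (m : ℕ) :
    ((monics F m ×ˢ monics F m).filter fun p : F[X] × F[X] =>
      toLaurent p.1 * invert (toLaurent p.1) = toLaurent p.2 * invert (toLaurent p.2)).card ≤
      (m + 1) ^ 3 * Fintype.card F ^ m := by
  refine le_trans ?_ (sum_card_monicDivisors_sq_le (F := F) m)
  have h1 : ((monics F m ×ˢ monics F m).filter fun p : F[X] × F[X] =>
      toLaurent p.1 * invert (toLaurent p.1) = toLaurent p.2 * invert (toLaurent p.2)) ⊆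
      (monics F m).biUnion fun g => (monicDivisors (g * g.reverse)).image fun d => (g, d) := by
    rintro ⟨g, d⟩ h
    simp only [Finset.mem_filter, Finset.mem_product] at h
    obtain ⟨⟨hg, hd⟩, h⟩ := h
    have hgm := mem_monics.1 hg
    have hdm := mem_monics.1 hd
    have h2 : g * g.reverse = d * d.reverse := by
      apply toLaurent_injective
      rw [map_mul, map_mul, toLaurent_reverse, toLaurent_reverse, ← mul_assoc, ← mul_assoc, h,
        hgm.2, hdm.2]
    refine Finset.mem_biUnion.2 ⟨g, hg, Finset.mem_image.2 ⟨d, ?_, rfl⟩⟩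
    have hg0 : g * g.reverse ≠ 0 := mul_ne_zero hgm.1.ne_zero (by simpa using hgm.1.ne_zero)
    exact (mem_monicDivisors hg0).2 ⟨hdm.1, h2 ▸ dvd_mul_right _ _⟩
  refine (Finset.card_le_card h1).trans (Finset.card_biUnion_le.trans (Finset.sum_le_sum ?_))
  intro g hg
  have hg0 := (mem_monics.1 hg).1.ne_zero
  refine Finset.card_image_le.trans ((card_monicDivisors_mul_le hg0 (by simpa using hg0)).trans ?_)
  rw [sq]
  exact Nat.mul_le_mul_left _ (card_monicDivisors_reverse_le hg0)

end MonicPolynomials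

/-! ### Character sums: differencing, Cauchy–Schwarz, representation counts -/

section ExponentialSums

theorem norm_sum_addChar_linearMap {F G : Type*} [Field F] [AddCommGroup G] [Fintype G] [Module F G]
    {ψ : AddChar F ℂ} (hψ : ψ ≠ 0) (ℓ : G →ₗ[F] F) [Decidable (ℓ = 0)] :
    ‖∑ x, ψ (ℓ x)‖ = if ℓ = 0 then (Fintype.card G : ℝ) else 0 := by
  split_ifs with h
  · simp [h]
  · have h1 : ∑ x, (ψ.compAddMonoidHom ℓ.toAddMonoidHom) x = 0 := by
      rw [AddChar.sum_eq_zero_iff_ne_zero, AddChar.ne_zero_iff]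
      obtain ⟨a, ha⟩ := AddChar.ne_zero_iff.1 hψ
      obtain ⟨x, hx⟩ := LinearMap.surjective h a
      exact ⟨x, by simpa [hx] using ha⟩
    simpa using h1

open Classical in
-- Weyl differencing for a quadratic phase. After the substitution `x ↦ x + e`, the inner sum over
-- `x` has a linear phase, so it vanishes unless that linear form is zero.
theorem norm_sum_addChar_sq_le {F G : Type*} [Field F] [Fintype F] [AddCommGroup G] [Fintype G]
    [Module F G] {ψ : AddChar F ℂ} (hψ : ψ ≠ 0) (p : G → F) (ℓ : G → G →ₗ[F] F) (c : G → F)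
    (h : ∀ x e, p (x + e) - p x = ℓ e x + c e) :
    ‖∑ x, ψ (p x)‖ ^ 2 ≤ (Fintype.card G : ℝ) * ((Finset.univ.filter fun e => ℓ e = 0).card : ℝ) := by
  have h1 : ((‖∑ x, ψ (p x)‖ ^ 2 : ℝ) : ℂ) = ∑ e, ψ (c e) * ∑ x, ψ (ℓ e x) := by
    push_cast
    rw [← Complex.mul_conj', map_sum, Finset.sum_mul_sum, Finset.sum_comm]
    simp only [Finset.mul_sum]
    rw [Finset.sum_comm (s := Finset.univ) (t := Finset.univ) (f := fun e x => ψ (c e) * ψ (ℓ e x))]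
    refine Finset.sum_congr rfl fun x _ => ?_
    rw [← Equiv.sum_comp (Equiv.addLeft x)]
    refine Finset.sum_congr rfl fun e _ => ?_
    rw [← AddChar.map_neg_eq_conj, ← AddChar.map_add_eq_mul, ← AddChar.map_add_eq_mul,
      ← sub_eq_add_neg, Equiv.coe_addLeft, h, add_comm]
  have h2 : ‖∑ x, ψ (p x)‖ ^ 2 = ‖∑ e, ψ (c e) * ∑ x, ψ (ℓ e x)‖ := by
    rw [← h1, Complex.norm_real, Real.norm_of_nonneg (by positivity)]
  rw [h2]
  refine (norm_sum_le _ _).trans ?_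
  simp only [norm_mul, AddChar.norm_apply, one_mul, norm_sum_addChar_linearMap hψ]
  rw [← Finset.sum_filter, Finset.sum_const, nsmul_eq_mul, mul_comm]

/-- The Cauchy–Schwarz inequality applied twice to a bilinear form. -/
theorem norm_bilinear_sum_pow_four_le {ι κ : Type*} (s : Finset ι) (t : Finset κ) (α : ι → ℂ)
    (β : κ → ℂ) (K : ι → κ → ℂ) :
    ‖∑ x ∈ s, ∑ y ∈ t, α x * β y * K x y‖ ^ 4 ≤
      (∑ x ∈ s, ‖α x‖ ^ 2) ^ 2 * (∑ y ∈ t, ‖β y‖ ^ 2) ^ 2 *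
        ∑ p ∈ t ×ˢ t, ‖∑ x ∈ s, K x p.1 * (starRingEnd ℂ) (K x p.2)‖ ^ 2 := by
  set A := ∑ x ∈ s, ‖α x‖ ^ 2
  set B := ∑ y ∈ t, ‖β y‖ ^ 2 with hB
  have h1 : ‖∑ x ∈ s, ∑ y ∈ t, α x * β y * K x y‖ ^ 2 ≤
      A * ∑ x ∈ s, ‖∑ y ∈ t, β y * K x y‖ ^ 2 := by
    refine le_trans ?_ (Finset.sum_mul_sq_le_sq_mul_sq _ _ _)
    gcongr
    refine (norm_sum_le _ _).trans (Finset.sum_le_sum fun x _ => ?_)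
    rw [← norm_mul, Finset.mul_sum]
    simp only [mul_assoc, le_refl]
  have h2 : ∑ x ∈ s, ‖∑ y ∈ t, β y * K x y‖ ^ 2 ≤
      ∑ p ∈ t ×ˢ t, (‖β p.1‖ * ‖β p.2‖) * ‖∑ x ∈ s, K x p.1 * (starRingEnd ℂ) (K x p.2)‖ := by
    have h3 : ((∑ x ∈ s, ‖∑ y ∈ t, β y * K x y‖ ^ 2 : ℝ) : ℂ) = ∑ p ∈ t ×ˢ t,
        (β p.1 * (starRingEnd ℂ) (β p.2)) * ∑ x ∈ s, K x p.1 * (starRingEnd ℂ) (K x p.2) := by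
      push_cast
      simp only [← Complex.mul_conj', map_sum, Finset.sum_mul_sum]
      rw [Finset.sum_product, Finset.sum_comm]
      refine Finset.sum_congr rfl fun y _ => ?_
      rw [Finset.sum_comm]
      refine Finset.sum_congr rfl fun y' _ => ?_
      rw [Finset.mul_sum]
      refine Finset.sum_congr rfl fun x _ => ?_
      rw [map_mul]; ring
    have h4 : ∑ x ∈ s, ‖∑ y ∈ t, β y * K x y‖ ^ 2 = ‖∑ p ∈ t ×ˢ t,
        (β p.1 * (starRingEnd ℂ) (β p.2)) * ∑ x ∈ s, K x p.1 * (starRingEnd ℂ) (K x p.2)‖ := by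
      rw [← h3, Complex.norm_real, Real.norm_of_nonneg (by positivity)]
    rw [h4]
    refine (norm_sum_le _ _).trans (Finset.sum_le_sum fun p _ => ?_)
    rw [norm_mul, norm_mul, RCLike.norm_conj]
  have h5 : (∑ x ∈ s, ‖∑ y ∈ t, β y * K x y‖ ^ 2) ^ 2 ≤
      B ^ 2 * ∑ p ∈ t ×ˢ t, ‖∑ x ∈ s, K x p.1 * (starRingEnd ℂ) (K x p.2)‖ ^ 2 := by
    have h6 : B ^ 2 = ∑ p ∈ t ×ˢ t, (‖β p.1‖ * ‖β p.2‖) ^ 2 := by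
      rw [sq, hB, Finset.sum_mul_sum, ← Finset.sum_product']
      simp only [mul_pow]
    rw [h6]
    refine le_trans ?_ (Finset.sum_mul_sq_le_sq_mul_sq _ _ _)
    gcongr
  calc ‖∑ x ∈ s, ∑ y ∈ t, α x * β y * K x y‖ ^ 4
      = (‖∑ x ∈ s, ∑ y ∈ t, α x * β y * K x y‖ ^ 2) ^ 2 := by ring
    _ ≤ (A * ∑ x ∈ s, ‖∑ y ∈ t, β y * K x y‖ ^ 2) ^ 2 := by gcongr
    _ = A ^ 2 * (∑ x ∈ s, ‖∑ y ∈ t, β y * K x y‖ ^ 2) ^ 2 := by ring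
    _ ≤ A ^ 2 * (B ^ 2 * _) := by gcongr
    _ = _ := by ring

/-- A difference takes no value more often than the value zero. -/
theorem card_filter_sub_eq_le {ι A : Type*} [AddCommGroup A] [DecidableEq A] (s : Finset ι) (N : ι → A) (z : A) :
    ((s ×ˢ s).filter fun p => N p.1 - N p.2 = z).card ≤
      ((s ×ˢ s).filter fun p => N p.1 = N p.2).card := by
  set ν : A → ℕ := fun w => (s.filter fun x => N x = w).card with hν
  have key : ∀ z, ((s ×ˢ s).filter fun p => N p.1 - N p.2 = z).card =
      ∑ w ∈ s.image N, ν (w + z) * ν w := by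
    intro z
    rw [Finset.card_eq_sum_card_fiberwise (f := fun p => N p.2) (t := s.image N)]
    · refine Finset.sum_congr rfl fun w _ => ?_
      rw [hν, ← Finset.card_product]
      congr 1
      ext ⟨x, y⟩
      simp only [Finset.mem_filter, Finset.mem_product]
      constructor
      · rintro ⟨⟨⟨hx, hy⟩, h⟩, rfl⟩
        exact ⟨⟨hx, by rw [← h]; abel⟩, hy, rfl⟩
      · rintro ⟨⟨hx, h⟩, hy, rfl⟩
        exact ⟨⟨⟨hx, hy⟩, by rw [h]; abel⟩, rfl⟩
    · intro p hp
      have hp := Finset.mem_filter.1 (Finset.mem_coe.1 hp)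
      exact Finset.mem_coe.2 (Finset.mem_image_of_mem _ (Finset.mem_product.1 hp.1).2)
  have h0 : ((s ×ˢ s).filter fun p => N p.1 = N p.2).card = ∑ w ∈ s.image N, ν w ^ 2 := by
    have := key 0
    simp only [sub_eq_zero, add_zero, ← sq] at this
    exact this
  -- Translation by `z` is injective and `ν` vanishes off the image, so the left side is a partial
  -- sum of the right one. The result then follows from `2ab ≤ a² + b²`.
  have h1 : ∑ w ∈ s.image N, ν (w + z) ^ 2 ≤ ∑ w ∈ s.image N, ν w ^ 2 := by
    rw [← Finset.sum_image (s := s.image N) (g := fun w => w + z) (f := fun w => ν w ^ 2)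
      (fun a _ b _ h => add_right_cancel h)]
    refine Finset.sum_le_sum_of_ne_zero fun w _ hw => ?_
    have hw : 0 < (s.filter fun x => N x = w).card := Nat.pos_of_ne_zero fun h => hw (by simp [hν, h])
    obtain ⟨x, hx⟩ := Finset.card_pos.1 hw
    exact Finset.mem_image.2 ⟨x, Finset.mem_filter.1 hx⟩
  have h2 : 2 * ∑ w ∈ s.image N, ν (w + z) * ν w ≤
      ∑ w ∈ s.image N, ν (w + z) ^ 2 + ∑ w ∈ s.image N, ν w ^ 2 := by
    rw [Finset.mul_sum, ← Finset.sum_add_distrib]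
    refine Finset.sum_le_sum fun w _ => ?_
    rw [← mul_assoc]
    exact two_mul_le_add_sq _ _
  rw [key, h0]
  omega

end ExponentialSums

/-! ### Type I and type II estimates for the Rudin–Shapiro phase -/

section RudinShapiroSums
open LaurentPolynomial

variable {F : Type*} [Field F]

/-- The linear functional `x ↦ shiftSum (x W)` on polynomials of degree less than `k`. -/
noncomputable def shiftPairing (k : ℕ) (W : F[T;T⁻¹]) : degreeLT F k →ₗ[F] F :=
  shiftSum ∘ₗ LinearMap.mulRight F W ∘ₗ toLaurentAlg.toLinearMap ∘ₗ (degreeLT F k).subtype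

theorem shiftPairing_apply (k : ℕ) (W : F[T;T⁻¹]) (x : degreeLT F k) :
    shiftPairing k W x = shiftSum (toLaurent (x : F[X]) * W) := by
  simp [shiftPairing]

theorem coeff_eq_zero_of_shiftPairing_eq_zero {k : ℕ} {W : F[T;T⁻¹]} (h : shiftPairing k W = 0)
    {i : ℕ} (hi : i < k) : (neighbourSum F * invert W).coeff i = 0 :=
  coeff_eq_zero_of_shiftSum_eq_zero (fun x hx => by
    rw [← shiftPairing_apply k W ⟨x, hx⟩, h, LinearMap.zero_apply]) hi

theorem nextCoeff_X_pow_add {m : ℕ} (hm : 1 ≤ m) (x : degreeLT F m) :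
    (X ^ m + (x : F[X])).nextCoeff = (x : F[X]).coeff (m - 1) := by
  have h := natDegree_X_pow_add_degreeLT x
  rw [nextCoeff_of_natDegree_pos (by omega), h, coeff_add, coeff_X_pow, if_neg (by omega), zero_add]

theorem toLaurent_mul_invert_coeff_eq_zero (f : F[X]) {l : ℤ}
    (hl : l < -(f.natDegree : ℤ) ∨ (f.natDegree : ℤ) < l) :
    (toLaurent f * invert (toLaurent f)).coeff l = 0 := by
  have key : ∀ l : ℤ, l < -(f.natDegree : ℤ) →
      (toLaurent f * invert (toLaurent f)).coeff l = 0 := by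
    intro l hl
    rw [toLaurent_mul_coeff]
    refine Finset.sum_eq_zero fun i _ => ?_
    rw [invert_apply, coeff_toLaurent_of_natDegree_lt _ (by omega), mul_zero]
  rcases hl with hl | hl
  · exact key l hl
  · rw [← neg_neg l, ← invert_apply, map_mul, involutive_invert (toLaurent f), mul_comm]
    exact key _ (by omega)

variable [Fintype F] {ψ : AddChar F ℂ}

theorem norm_sum_rudinShapiro_mul_sq_le (hψ : ψ ≠ 0) {D m : ℕ} {a : F[X]} (ha : a ∈ monics F D)
    (hm : 1 ≤ m) : ‖∑ g ∈ monics F m, ψ (rudinShapiro (a * g))‖ ^ 2 ≤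
      (Fintype.card F : ℝ) ^ (D + m + 1) := by
  classical
  obtain ⟨ham, haD⟩ := mem_monics.1 ha
  rw [sum_monics]
  set W : degreeLT F m → F[T;T⁻¹] := fun e => toLaurent a * invert (toLaurent (a * (e : F[X])))
  have hR : ∀ x : degreeLT F m, rudinShapiro (a * (X ^ m + (x : F[X]))) =
      autocorr (a * (X ^ m + (x : F[X]))) - (a.nextCoeff + (x : F[X]).coeff (m - 1)) := by
    intro x
    have hx := monic_X_pow_add_degreeLT x
    rw [rudinShapiro_eq_autocorr_sub (ham.mul hx), ham.nextCoeff_mul hx, nextCoeff_X_pow_add hm]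
    rw [ham.natDegree_mul hx, natDegree_X_pow_add_degreeLT]
    omega
  refine (norm_sum_addChar_sq_le hψ _ (fun e => shiftPairing m (W e))
    (fun e => shiftSum (toLaurent (X ^ m) * W e) + autocorr (a * (e : F[X]))
      - (e : F[X]).coeff (m - 1)) ?_).trans ?_
  · intro x e
    rw [hR, hR, shiftPairing_apply, Submodule.coe_add, ← add_assoc, mul_add a _ (e : F[X]),
      autocorr_add, coeff_add]
    have : shiftSum (toLaurent (a * (X ^ m + (x : F[X]))) * invert (toLaurent (a * (e : F[X])))) =
        shiftSum (toLaurent (x : F[X]) * W e) + shiftSum (toLaurent (X ^ m) * W e) := by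
      rw [← map_add]
      congr 1
      simp only [W, map_mul, map_add]
      ring
    rw [this]
    ring
  · rw [card_degreeLT, show D + m + 1 = m + (D + 1) by ring, pow_add]
    push_cast
    gcongr
    have h1 : (Finset.univ.filter fun e => shiftPairing m (W e) = 0).card ≤
        (Finset.univ : Finset (Fin (D + 1) → F)).card := by
      refine Finset.card_le_card_of_injOn (fun e j => (e : F[X]).coeff j)
        (fun _ _ => Finset.mem_coe.2 (Finset.mem_univ _)) ?_
      intro e he e' he' hee
      simp only [Finset.coe_filter, Finset.mem_univ, true_and, Set.mem_ofPred_eq] at he he'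
      -- The linear form attached to `e` vanishes only if `A * e` has zero coefficients at `0, …,
      -- m-1`. Here `A` is symmetric and supported in `[-(D+1), D+1]`, so the first `D + 1`
      -- coefficients of `e` determine it.
      set A : F[T;T⁻¹] := neighbourSum F * (toLaurent a * invert (toLaurent a)) with hA
      have hAW : ∀ e : degreeLT F m, neighbourSum F * invert (W e) = A * toLaurent (e : F[X]) := by
        intro e
        simp only [W, hA, map_mul, involutive_invert (toLaurent a),
          involutive_invert (toLaurent (e : F[X]))]
        ring
      have ha0 : toLaurent a ≠ 0 := toLaurent_ne_zero.2 ham.ne_zero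
      have h0 : ((e - e' : degreeLT F m) : F[X]) = 0 := by
        refine eq_zero_of_symm_mul_coeff_eq_zero (A := A) (D := D + 1) (m := m) ?_ ?_ ?_
          (e - e').2 ?_ ?_
        · exact mul_ne_zero neighbourSum_ne_zero (mul_ne_zero ha0 (by simpa using ham.ne_zero))
        · rw [hA, map_mul, map_mul, involutive_invert (toLaurent a), invert_neighbourSum,
            mul_comm (invert _)]
        · intro l hl
          by_contra hcon
          push Not at hcon
          push_cast at hcon
          rw [hA, neighbourSum_mul_coeff, toLaurent_mul_invert_coeff_eq_zero _ (Or.inl (by omega)),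
            toLaurent_mul_invert_coeff_eq_zero _ (Or.inl (by omega))] at hl
          simp at hl
        · intro i hi
          have h2 := coeff_eq_zero_of_shiftPairing_eq_zero he hi
          have h3 := coeff_eq_zero_of_shiftPairing_eq_zero he' hi
          rw [hAW] at h2 h3
          rw [Submodule.coe_sub, map_sub, mul_sub, AddMonoidAlgebra.coeff_sub, Finsupp.sub_apply,
            h2, h3, sub_zero]
        · intro j hj
          have := congrFun hee ⟨j, hj⟩
          simp only at this
          rw [Submodule.coe_sub, coeff_sub, this, sub_self]
      exact sub_eq_zero.1 (Subtype.ext h0)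
    have h2 : (Finset.univ : Finset (Fin (D + 1) → F)).card = Fintype.card F ^ (D + 1) := by
      rw [Finset.card_univ]; simp
    rw [h2] at h1
    exact_mod_cast h1

open Classical in
-- The last two factors count, respectively, the pairs with a given difference `N(g) - N(g')`, and
-- the differences allowed by the vanishing condition. The multiplier `(T + 1/T) e` is supported in
-- `[-1, k]`, as `exists_finset_determining_symm` requires.
theorem card_shiftPairing_eq_zero_le {k m : ℕ} (hkm : k ≤ m) {e : degreeLT F k} (he : e ≠ 0) :
    ((monics F m ×ˢ monics F m).filter fun p : F[X] × F[X] =>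
      shiftPairing k (invert (toLaurent (e : F[X])) * (toLaurent p.1 * invert (toLaurent p.1)
        - toLaurent p.2 * invert (toLaurent p.2))) = 0).card ≤
      (m + 1) ^ 3 * Fintype.card F ^ m * Fintype.card F ^ (m + 1 - k / 2) := by
  set N : F[X] → F[T;T⁻¹] := fun g => toLaurent g * invert (toLaurent g) with hN
  have he0 : (e : F[X]) ≠ 0 := fun h => he (Subtype.ext h)
  set E : F[T;T⁻¹] := neighbourSum F * toLaurent (e : F[X]) with hE
  have hk : (e : F[X]).natDegree < k := by
    rw [natDegree_lt_iff_degree_lt he0]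
    exact degree_lt_of_mem_degreeLT e
  obtain ⟨J, hJ, H⟩ := exists_finset_determining_symm (E := E)
    (mul_ne_zero neighbourSum_ne_zero (toLaurent_ne_zero.2 he0)) hkm (by
      intro l hl
      by_contra hcon
      rw [hE, neighbourSum_mul_coeff, coeff_toLaurent_of_neg _ (by omega),
        coeff_toLaurent_of_neg _ (by omega)] at hl
      simp at hl) (by
      intro l hl
      by_contra hcon
      rw [hE, neighbourSum_mul_coeff, coeff_toLaurent_of_natDegree_lt _ (by omega),
        coeff_toLaurent_of_natDegree_lt _ (by omega)] at hl
      simp at hl)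
  have hNs : ∀ g, invert (N g) = N g := by
    intro g
    rw [hN, map_mul, involutive_invert (toLaurent g), mul_comm]
  set S := (monics F m ×ˢ monics F m).filter fun p : F[X] × F[X] =>
      shiftPairing k (invert (toLaurent (e : F[X])) * (N p.1 - N p.2)) = 0 with hS
  have hK : ((monics F m ×ˢ monics F m).filter fun p => N p.1 = N p.2).card ≤
      (m + 1) ^ 3 * Fintype.card F ^ m := by
    exact card_eq_toLaurent_mul_invert_le (F := F) m
  have h1 : S.card ≤ (m + 1) ^ 3 * Fintype.card F ^ m * (S.image fun p => N p.1 - N p.2).card := by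
    refine Finset.card_le_mul_card_image _ _ fun z _ => ?_
    have h2 := card_filter_sub_eq_le (monics F m) N z
    refine (Finset.card_le_card ?_).trans (h2.trans hK)
    intro p hp
    obtain ⟨hp1, hp2⟩ := Finset.mem_filter.1 hp
    exact Finset.mem_filter.2 ⟨(Finset.mem_filter.1 hp1).1, hp2⟩
  refine h1.trans (Nat.mul_le_mul_left _ ?_)
  have h2 : (S.image fun p => N p.1 - N p.2).card ≤ (Finset.univ : Finset (J → F)).card := by
    refine Finset.card_le_card_of_injOn (fun Z j => Z.coeff j)
      (fun _ _ => Finset.mem_coe.2 (Finset.mem_univ _)) ?_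
    have hprop : ∀ Z ∈ S.image (fun p => N p.1 - N p.2), invert Z = Z ∧
        (∀ j : ℤ, m < j → Z.coeff j = 0) ∧ ∀ i < k, (E * Z).coeff (i : ℤ) = 0 := by
      intro Z hZ
      obtain ⟨p, hp, rfl⟩ := Finset.mem_image.1 hZ
      obtain ⟨hp1, hp2⟩ := Finset.mem_filter.1 hp
      rw [Finset.mem_product, mem_monics, mem_monics] at hp1
      have hs : invert (N p.1 - N p.2) = N p.1 - N p.2 := by rw [map_sub, hNs, hNs]
      refine ⟨hs, ?_, ?_⟩
      · intro j hj
        rw [AddMonoidAlgebra.coeff_sub, Finsupp.sub_apply,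
          toLaurent_mul_invert_coeff_eq_zero _ (Or.inr (by omega)),
          toLaurent_mul_invert_coeff_eq_zero _ (Or.inr (by omega)), sub_zero]
      · intro i hi
        have := coeff_eq_zero_of_shiftPairing_eq_zero hp2 hi
        rwa [map_mul, hs, involutive_invert (toLaurent (e : F[X])), ← mul_assoc] at this
    intro Z hZ Z' hZ' hZZ
    obtain ⟨a1, a2, a3⟩ := hprop Z hZ
    obtain ⟨b1, b2, b3⟩ := hprop Z' hZ'
    refine sub_eq_zero.1 (H (Z - Z') (by rw [map_sub, a1, b1]) ?_ ?_ ?_)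
    · intro j hj
      rw [AddMonoidAlgebra.coeff_sub, Finsupp.sub_apply, a2 j hj, b2 j hj, sub_zero]
    · intro i hi
      rw [mul_sub, AddMonoidAlgebra.coeff_sub, Finsupp.sub_apply, a3 i hi, b3 i hi, sub_zero]
    · intro j hj
      rw [AddMonoidAlgebra.coeff_sub, Finsupp.sub_apply]
      exact sub_eq_zero.2 (congrFun hZZ ⟨j, hj⟩)
  refine h2.trans (le_of_eq ?_)
  rw [Finset.card_univ, Fintype.card_fun, Fintype.card_coe, hJ]

/-- After the two Cauchy–Schwarz steps, the phase `R(dg) - R(dg')` is differenced in `d`. The terms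
`nextCoeff d` cancel between `g` and `g'`, and only `N(g) - N(g')` enters the linear form. -/
theorem norm_bilinear_rudinShapiro_pow_four_le (hψ : ψ ≠ 0) {k m : ℕ} (hk : 1 ≤ k) (hkm : k ≤ m)
    (α β : F[X] → ℂ) :
    ‖∑ d ∈ monics F k, ∑ g ∈ monics F m, α d * β g * ψ (rudinShapiro (d * g))‖ ^ 4 ≤
      (∑ d ∈ monics F k, ‖α d‖ ^ 2) ^ 2 * (∑ g ∈ monics F m, ‖β g‖ ^ 2) ^ 2 *
        (2 * (m + 1) ^ 3 * (Fintype.card F : ℝ) ^ (2 * k + 2 * m + 1 - k / 2)) := by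
  classical
  refine (norm_bilinear_sum_pow_four_le _ _ α β fun d g => ψ (rudinShapiro (d * g))).trans ?_
  gcongr
  set N : F[X] → F[T;T⁻¹] := fun g => toLaurent g * invert (toLaurent g) with hN
  have h1 : ∀ p ∈ monics F m ×ˢ monics F m, ‖∑ d ∈ monics F k, ψ (rudinShapiro (d * p.1)) *
      (starRingEnd ℂ) (ψ (rudinShapiro (d * p.2)))‖ ^ 2 ≤ (Fintype.card F : ℝ) ^ k *
        ((Finset.univ.filter fun e : degreeLT F k =>
          shiftPairing k (invert (toLaurent (e : F[X])) * (N p.1 - N p.2)) = 0).card : ℝ) := by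
    rintro ⟨g, g'⟩ hp
    rw [Finset.mem_product, mem_monics, mem_monics] at hp
    obtain ⟨⟨hg, hgm⟩, hg', hgm'⟩ := hp
    have h2 : ∀ d, ψ (rudinShapiro (d * g)) * (starRingEnd ℂ) (ψ (rudinShapiro (d * g'))) =
        ψ (rudinShapiro (d * g) - rudinShapiro (d * g')) := by
      intro d
      rw [← AddChar.map_neg_eq_conj, ← AddChar.map_add_eq_mul, sub_eq_add_neg]
    simp only [h2]
    rw [sum_monics]
    have hR : ∀ (g : F[X]), g.Monic → ∀ x : degreeLT F k, rudinShapiro ((X ^ k + (x : F[X])) * g) =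
        autocorr ((X ^ k + (x : F[X])) * g) - ((x : F[X]).coeff (k - 1) + g.nextCoeff) := by
      intro g hg x
      have hx := monic_X_pow_add_degreeLT x
      rw [rudinShapiro_eq_autocorr_sub (hx.mul hg), hx.nextCoeff_mul hg, nextCoeff_X_pow_add hk]
      rw [hx.natDegree_mul hg, natDegree_X_pow_add_degreeLT]
      omega
    refine (norm_sum_addChar_sq_le hψ _
      (fun e => shiftPairing k (invert (toLaurent (e : F[X])) * (N g - N g')))
      (fun e => shiftSum (toLaurent (X ^ k) * (invert (toLaurent (e : F[X])) * (N g - N g')))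
        + autocorr ((e : F[X]) * g) - autocorr ((e : F[X]) * g')) ?_).trans ?_
    · intro x e
      rw [hR g hg, hR g' hg', hR g hg, hR g' hg', shiftPairing_apply, Submodule.coe_add,
        ← add_assoc, add_mul _ (e : F[X]), add_mul _ (e : F[X]), autocorr_add, autocorr_add]
      have h3 : shiftSum (toLaurent ((X ^ k + (x : F[X])) * g) *
            invert (toLaurent ((e : F[X]) * g))) -
          shiftSum (toLaurent ((X ^ k + (x : F[X])) * g') *
            invert (toLaurent ((e : F[X]) * g'))) =
          shiftSum (toLaurent (x : F[X]) * (invert (toLaurent (e : F[X])) * (N g - N g'))) +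
          shiftSum (toLaurent (X ^ k) * (invert (toLaurent (e : F[X])) * (N g - N g'))) := by
        rw [← map_add, ← map_sub]
        congr 1
        simp only [hN, map_mul, map_add]
        ring
      linear_combination h3
    · rw [card_degreeLT]
      push_cast
      exact le_rfl
  refine (Finset.sum_le_sum h1).trans ?_
  rw [← Finset.mul_sum]
  have h4 : ∑ p ∈ monics F m ×ˢ monics F m, (Finset.univ.filter fun e : degreeLT F k =>
      shiftPairing k (invert (toLaurent (e : F[X])) * (N p.1 - N p.2)) = 0).card ≤
      2 * (m + 1) ^ 3 * Fintype.card F ^ (k + 2 * m + 1 - k / 2) := by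
    simp only [Finset.card_filter]
    rw [Finset.sum_comm]
    simp only [← Finset.card_filter]
    -- For `e = 0` every pair satisfies the condition. This diagonal costs `q^(2m)`, which is within
    -- the bound for the other `e`; hence the factor `2`.
    rw [← Finset.add_sum_erase _ _ (Finset.mem_univ (0 : degreeLT F k))]
    have hq : 1 ≤ Fintype.card F := Fintype.card_pos
    have h5 : ((monics F m ×ˢ monics F m).filter fun p : F[X] × F[X] => shiftPairing k
        (invert (toLaurent ((0 : degreeLT F k) : F[X])) * (N p.1 - N p.2)) = 0).card ≤
        (m + 1) ^ 3 * Fintype.card F ^ (k + 2 * m + 1 - k / 2) := by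
      refine (Finset.card_filter_le _ _).trans ?_
      rw [Finset.card_product, card_monics, ← pow_add]
      calc Fintype.card F ^ (m + m) ≤ Fintype.card F ^ (k + 2 * m + 1 - k / 2) :=
            Nat.pow_le_pow_right hq (by omega)
        _ ≤ _ := Nat.le_mul_of_pos_left _ (by positivity)
    have h6 : ∑ e ∈ Finset.univ.erase (0 : degreeLT F k),
        ((monics F m ×ˢ monics F m).filter fun p : F[X] × F[X] => shiftPairing k
          (invert (toLaurent (e : F[X])) * (N p.1 - N p.2)) = 0).card ≤
        (m + 1) ^ 3 * Fintype.card F ^ (k + 2 * m + 1 - k / 2) := by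
      refine (Finset.sum_le_card_nsmul _ _
        ((m + 1) ^ 3 * Fintype.card F ^ m * Fintype.card F ^ (m + 1 - k / 2)) ?_).trans ?_
      · intro e he
        exact card_shiftPairing_eq_zero_le hkm (Finset.ne_of_mem_erase he)
      · rw [smul_eq_mul]
        calc _ ≤ Fintype.card F ^ k *
              ((m + 1) ^ 3 * Fintype.card F ^ m * Fintype.card F ^ (m + 1 - k / 2)) := by
              gcongr
              rw [← card_degreeLT]
              exact Finset.card_le_univ _
          _ = (m + 1) ^ 3 * Fintype.card F ^ (k + m + (m + 1 - k / 2)) := by ring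
          _ = _ := by congr 2; omega
    calc _ ≤ _ := Nat.add_le_add h5 h6
      _ = _ := by ring
  calc (Fintype.card F : ℝ) ^ k * _ ≤ (Fintype.card F : ℝ) ^ k *
        (2 * (m + 1) ^ 3 * (Fintype.card F : ℝ) ^ (k + 2 * m + 1 - k / 2)) := by
        gcongr
        exact_mod_cast h4
    _ = 2 * (m + 1) ^ 3 * (Fintype.card F : ℝ) ^ (k + (k + 2 * m + 1 - k / 2)) := by
        rw [pow_add _ k]; ring
    _ = _ := by congr 2; omega

end RudinShapiroSums

/-! ### Möbius and von Mangoldt functions on polynomials -/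

section Moebius

variable {F : Type*} [Field F]

open Classical in
/-- The Möbius function on polynomials. -/
noncomputable def polyMoebius (f : F[X]) : ℝ :=
  if Squarefree f then (-1) ^ (UniqueFactorizationMonoid.normalizedFactors f).card else 0

theorem abs_polyMoebius_le (f : F[X]) : |polyMoebius f| ≤ 1 := by
  unfold polyMoebius
  split_ifs <;> simp

theorem polyMoebius_irreducible_mul {p d : F[X]} (hp : Irreducible p) (hd : Squarefree d)
    (h : ¬ p ∣ d) : polyMoebius (p * d) = - polyMoebius d := by
  classical
  have h1 : IsRelPrime p d := (hp.isRelPrime_iff_not_dvd).2 h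
  have h2 : Squarefree (p * d) := squarefree_mul_iff.2 ⟨h1, hp.squarefree, hd⟩
  rw [polyMoebius, polyMoebius, if_pos h2, if_pos hd,
    UniqueFactorizationMonoid.normalizedFactors_mul hp.ne_zero hd.ne_zero,
    UniqueFactorizationMonoid.normalizedFactors_irreducible hp]
  simp [pow_add]

open Classical in
/-- The von Mangoldt function on polynomials, with the degree in the place of the logarithm. -/
noncomputable def polyMangoldt (f : F[X]) : ℝ :=
  if h : ∃ p : F[X], (p.Monic ∧ Irreducible p) ∧ ∃ j, 0 < j ∧ p ^ j = f then
    (h.choose.natDegree : ℝ) else 0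

/-- Uniqueness of the prime base makes the choice in `polyMangoldt` immaterial. -/
theorem eq_of_irreducible_pow_eq {p r : F[X]} (hp : p.Monic ∧ Irreducible p)
    (hr : r.Monic ∧ Irreducible r) {i j : ℕ} (hi : 0 < i) (h : p ^ i = r ^ j) : p = r := by
  have h1 : p ∣ r := hp.2.prime.dvd_of_dvd_pow (h ▸ dvd_pow_self p hi.ne')
  exact eq_of_monic_of_associated hp.1 hr.1 (hp.2.associated_of_dvd hr.2 h1)

theorem polyMangoldt_pow {p : F[X]} (hp : p.Monic ∧ Irreducible p) {j : ℕ} (hj : 0 < j) :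
    polyMangoldt (p ^ j) = p.natDegree := by
  have h : ∃ r : F[X], (r.Monic ∧ Irreducible r) ∧ ∃ i, 0 < i ∧ r ^ i = p ^ j :=
    ⟨p, hp, j, hj, rfl⟩
  rw [polyMangoldt, dif_pos h]
  obtain ⟨h1, i, hi, h2⟩ := h.choose_spec
  rw [eq_of_irreducible_pow_eq h1 hp hi h2]

theorem exists_pow_of_polyMangoldt_ne_zero {f : F[X]} (hf : polyMangoldt f ≠ 0) :
    ∃ p : F[X], (p.Monic ∧ Irreducible p) ∧ ∃ j, 0 < j ∧ p ^ j = f := by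
  by_contra h
  exact hf (dif_neg h)

theorem polyMangoldt_nonneg (f : F[X]) : 0 ≤ polyMangoldt f := by
  unfold polyMangoldt
  split_ifs <;> positivity

theorem polyMangoldt_le (f : F[X]) : polyMangoldt f ≤ f.natDegree := by
  by_cases h : polyMangoldt f = 0
  · rw [h]; positivity
  obtain ⟨p, hp, j, hj, rfl⟩ := exists_pow_of_polyMangoldt_ne_zero h
  rw [polyMangoldt_pow hp hj, natDegree_pow]
  exact_mod_cast Nat.le_mul_of_pos_left _ hj

theorem polyMangoldt_one : polyMangoldt (1 : F[X]) = 0 := by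
  have := polyMangoldt_le (1 : F[X])
  rw [natDegree_one, Nat.cast_zero] at this
  exact le_antisymm this (polyMangoldt_nonneg _)

/-- The restriction of a function to polynomials of degree at most `u`. -/
noncomputable def lowPart (u : ℕ) (α : F[X] → ℝ) (f : F[X]) : ℝ := if f.natDegree ≤ u then α f else 0

/-- The restriction of a function to polynomials of degree greater than `u`. -/
noncomputable def highPart (u : ℕ) (α : F[X] → ℝ) (f : F[X]) : ℝ := if f.natDegree ≤ u then 0 else α f

theorem lowPart_add_highPart (u : ℕ) (α : F[X] → ℝ) (f : F[X]) :
    lowPart u α f + highPart u α f = α f := by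
  unfold lowPart highPart
  split_ifs <;> simp

theorem abs_lowPart_le {u : ℕ} {α : F[X] → ℝ} {f : F[X]} {b : ℝ} (h : |α f| ≤ b) :
    |lowPart u α f| ≤ b := by
  unfold lowPart
  split_ifs
  · exact h
  · simpa using (abs_nonneg _).trans h

theorem abs_highPart_le {u : ℕ} {α : F[X] → ℝ} {f : F[X]} {b : ℝ} (h : |α f| ≤ b) :
    |highPart u α f| ≤ b := by
  unfold highPart
  split_ifs
  · simpa using (abs_nonneg _).trans h
  · exact h

end Moebius

/-! ### Dirichlet convolution, Vaughan's identity and prime powers -/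

section ArithmeticFunctions

variable {F : Type*} [Field F] [Fintype F]

/-- Dirichlet convolution of functions on monic polynomials. -/
noncomputable def conv (α β : F[X] → ℝ) (f : F[X]) : ℝ := ∑ p ∈ factorPairs f, α p.1 * β p.2

theorem conv_comm (α β : F[X] → ℝ) {f : F[X]} (hf : f.Monic) : conv α β f = conv β α f := by
  refine Finset.sum_nbij' Prod.swap Prod.swap ?_ ?_ (fun _ _ => rfl) (fun _ _ => rfl)
    (fun p _ => mul_comm _ _)
  all_goals
    intro p hp
    obtain ⟨h1, h2, h3⟩ := (mem_factorPairs hf).1 hp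
    exact (mem_factorPairs hf).2 ⟨h2, h1, by rw [← h3]; exact mul_comm _ _⟩

theorem conv_congr {α α' β β' : F[X] → ℝ} (hα : ∀ f : F[X], f.Monic → α f = α' f)
    (hβ : ∀ f : F[X], f.Monic → β f = β' f) {f : F[X]} (hf : f.Monic) :
    conv α β f = conv α' β' f := by
  refine Finset.sum_congr rfl fun p hp => ?_
  obtain ⟨h1, h2, h3⟩ := (mem_factorPairs hf).1 hp
  rw [hα _ h1, hβ _ h2]

theorem conv_assoc (α β γ : F[X] → ℝ) {f : F[X]} (hf : f.Monic) :
    conv (conv α β) γ f = conv α (conv β γ) f := by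
  simp only [conv, Finset.sum_mul, Finset.mul_sum]
  rw [Finset.sum_sigma', Finset.sum_sigma']
  refine Finset.sum_nbij' (fun s => ⟨(s.2.1, s.2.2 * s.1.2), (s.2.2, s.1.2)⟩)
    (fun s => ⟨(s.1.1 * s.2.1, s.2.2), (s.1.1, s.2.1)⟩) ?_ ?_ ?_ ?_ ?_
  · rintro ⟨⟨a, b⟩, ⟨c, d⟩⟩ h
    obtain ⟨h, h'⟩ := Finset.mem_sigma.1 h
    obtain ⟨h1, h2, h3⟩ := (mem_factorPairs hf).1 h
    obtain ⟨h4, h5, h6⟩ := (mem_factorPairs h1).1 h'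
    dsimp only at h1 h2 h3 h4 h5 h6
    refine Finset.mem_sigma.2 ⟨(mem_factorPairs hf).2 ⟨h4, h5.mul h2, ?_⟩,
      (mem_factorPairs (h5.mul h2)).2 ⟨h5, h2, rfl⟩⟩
    rw [← h3, ← h6, mul_assoc]
  · rintro ⟨⟨a, b⟩, ⟨c, d⟩⟩ h
    obtain ⟨h, h'⟩ := Finset.mem_sigma.1 h
    obtain ⟨h1, h2, h3⟩ := (mem_factorPairs hf).1 h
    obtain ⟨h4, h5, h6⟩ := (mem_factorPairs h2).1 h'
    dsimp only at h1 h2 h3 h4 h5 h6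
    refine Finset.mem_sigma.2 ⟨(mem_factorPairs hf).2 ⟨h1.mul h4, h5, ?_⟩,
      (mem_factorPairs (h1.mul h4)).2 ⟨h1, h4, rfl⟩⟩
    rw [← h3, ← h6, mul_assoc]
  · rintro ⟨⟨a, b⟩, ⟨c, d⟩⟩ h
    obtain ⟨h, h'⟩ := Finset.mem_sigma.1 h
    obtain ⟨h1, h2, h3⟩ := (mem_factorPairs hf).1 h
    obtain ⟨h4, h5, h6⟩ := (mem_factorPairs h1).1 h'
    dsimp only at h6
    simp only [h6]
  · rintro ⟨⟨a, b⟩, ⟨c, d⟩⟩ h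
    obtain ⟨h, h'⟩ := Finset.mem_sigma.1 h
    obtain ⟨h1, h2, h3⟩ := (mem_factorPairs hf).1 h
    obtain ⟨h4, h5, h6⟩ := (mem_factorPairs h2).1 h'
    dsimp only at h6
    simp only [h6]
  · rintro ⟨⟨a, b⟩, ⟨c, d⟩⟩ _
    exact mul_assoc _ _ _

theorem conv_add_left (α α' β : F[X] → ℝ) (f : F[X]) :
    conv (fun g => α g + α' g) β f = conv α β f + conv α' β f := by
  simp only [conv, add_mul, Finset.sum_add_distrib]

theorem conv_add_right (α β β' : F[X] → ℝ) (f : F[X]) :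
    conv α (fun g => β g + β' g) f = conv α β f + conv α β' f := by
  simp only [conv, mul_add, Finset.sum_add_distrib]

theorem conv_const_one (α : F[X] → ℝ) {f : F[X]} (hf : f.Monic) :
    conv α (fun _ => 1) f = ∑ d ∈ monicDivisors f, α d := by
  rw [← sum_factorPairs_fst hf]
  simp [conv]

open Classical in
theorem conv_ite_eq_one (α : F[X] → ℝ) {f : F[X]} (hf : f.Monic) :
    conv α (fun g => if g = 1 then 1 else 0) f = α f := by
  rw [conv, Finset.sum_eq_single (f, 1)]
  · simp
  · rintro ⟨a, b⟩ hp hne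
    obtain ⟨h1, h2, h3⟩ := (mem_factorPairs hf).1 hp
    dsimp only at h1 h2 h3 ⊢
    rw [if_neg, mul_zero]
    rintro rfl
    exact hne (Prod.ext (by simpa using h3) rfl)
  · intro h
    refine absurd ?_ h
    rw [mem_factorPairs hf]
    exact ⟨hf, monic_one, mul_one f⟩

/-- For a monic irreducible `p ∣ f`, the map `d ↦ p * d` pairs the squarefree divisors prime to `p`
with those divisible by `p` and reverses the sign of the Möbius function. -/
theorem sum_polyMoebius_monicDivisors {f : F[X]} (hf : f.Monic) (h1 : f ≠ 1) :
    ∑ d ∈ monicDivisors f, polyMoebius d = 0 := by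
  classical
  obtain ⟨p, hpm, hp, hpf⟩ := exists_monic_irreducible_factor f (fun hu => h1 (hf.isUnit_iff.1 hu))
  have hsq : ∀ s : Finset F[X], ∑ d ∈ s, polyMoebius d = ∑ d ∈ s with Squarefree d, polyMoebius d := by
    intro s
    refine (Finset.sum_filter_of_ne fun d _ hd => ?_).symm
    by_contra hns
    exact hd (if_neg hns)
  rw [hsq, ← Finset.sum_filter_not_add_sum_filter _ (fun d => p ∣ d)]
  have key : ∑ d ∈ (monicDivisors f).filter Squarefree with p ∣ d, polyMoebius d =
      ∑ d ∈ (monicDivisors f).filter Squarefree with ¬ p ∣ d, - polyMoebius d := by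
    symm
    refine Finset.sum_nbij (fun d => p * d) ?_ ?_ ?_ ?_
    · intro d hd
      simp only [Finset.mem_filter, mem_monicDivisors hf.ne_zero] at hd ⊢
      obtain ⟨⟨⟨hdm, hdf⟩, hds⟩, hpd⟩ := hd
      refine ⟨⟨⟨hpm.mul hdm, ?_⟩, ?_⟩, dvd_mul_right _ _⟩
      · exact ((hp.coprime_iff_not_dvd).2 hpd).mul_dvd hpf hdf
      · exact squarefree_mul_iff.2 ⟨(hp.isRelPrime_iff_not_dvd).2 hpd, hp.squarefree, hds⟩
    · intro d _ d' _ h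
      exact mul_left_cancel₀ hp.ne_zero h
    · intro d hd
      simp only [Finset.coe_filter, Finset.mem_filter, mem_monicDivisors hf.ne_zero,
        Set.mem_ofPred_eq] at hd
      obtain ⟨⟨⟨hdm, hdf⟩, hds⟩, e, rfl⟩ := hd
      refine ⟨e, ?_, rfl⟩
      simp only [Finset.coe_filter, Finset.mem_filter, mem_monicDivisors hf.ne_zero,
        Set.mem_ofPred_eq]
      refine ⟨⟨⟨hpm.of_mul_monic_left hdm, (dvd_mul_left _ _).trans hdf⟩,
        (squarefree_mul_iff.1 hds).2.2⟩, fun hpe => ?_⟩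
      exact hp.not_isUnit (hds p (mul_dvd_mul_left p hpe))
    · intro d hd
      simp only [Finset.mem_filter] at hd
      rw [polyMoebius_irreducible_mul hp hd.1.2 hd.2]
  rw [key, Finset.sum_neg_distrib, add_neg_cancel]

open Classical in
theorem conv_polyMoebius_one {f : F[X]} (hf : f.Monic) :
    conv polyMoebius (fun _ => 1) f = if f = 1 then 1 else 0 := by
  rw [conv_const_one _ hf]
  split_ifs with h
  · subst h
    have : monicDivisors (1 : F[X]) = {1} := by
      ext d
      rw [mem_monicDivisors one_ne_zero, Finset.mem_singleton]
      constructor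
      · rintro ⟨h1, h2⟩
        exact h1.isUnit_iff.1 (isUnit_of_dvd_one h2)
      · rintro rfl
        exact ⟨monic_one, dvd_rfl⟩
    rw [this, Finset.sum_singleton, polyMoebius, if_pos squarefree_one]
    simp
  · exact sum_polyMoebius_monicDivisors hf h

/-- Induction on the degree: if `f = p * g` and `p^v` exactly divides `g`, then `p^(v+1)` is the
only prime power dividing `f` but not `g`, and it contributes `deg p`. -/
theorem sum_polyMangoldt_monicDivisors {f : F[X]} (hf : f.Monic) :
    ∑ d ∈ monicDivisors f, polyMangoldt d = f.natDegree := by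
  classical
  induction hn : f.natDegree using Nat.strong_induction_on generalizing f with
  | _ n ih =>
  subst hn
  by_cases h1 : f = 1
  · subst h1
    rw [natDegree_one, Nat.cast_zero]
    refine Finset.sum_eq_zero fun d hd => ?_
    obtain ⟨h1, h2⟩ := (mem_monicDivisors one_ne_zero).1 hd
    rw [h1.isUnit_iff.1 (isUnit_of_dvd_one h2), polyMangoldt_one]
  obtain ⟨p, hpm, hp, g, rfl⟩ :=
    exists_monic_irreducible_factor f (fun hu => h1 (hf.isUnit_iff.1 hu))
  have hg : g.Monic := hpm.of_mul_monic_left hf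
  have hdeg : (p * g).natDegree = p.natDegree + g.natDegree := hpm.natDegree_mul hg
  have hp0 : 0 < p.natDegree := hp.natDegree_pos
  obtain ⟨v, c, hc, hgc⟩ : ∃ v c, ¬ p ∣ c ∧ g = p ^ v * c :=
    (FiniteMultiplicity.of_not_isUnit hp.not_isUnit hg.ne_zero).exists_eq_pow_mul_and_not_dvd.elim
      fun c hc => ⟨_, c, hc.2, hc.1⟩
  have hnd : ∀ j, v < j → ¬ p ^ j ∣ g := by
    intro j hj h
    refine hc ?_
    have h2 : p ^ v * p ∣ p ^ v * c := by
      rw [← pow_succ, ← hgc]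
      exact (pow_dvd_pow p hj).trans h
    exact (mul_dvd_mul_iff_left (pow_ne_zero v hp.ne_zero)).1 h2
  have hsub : insert (p ^ (v + 1)) (monicDivisors g) ⊆ monicDivisors (p * g) := by
    intro d hd
    rw [mem_monicDivisors hf.ne_zero]
    rcases Finset.mem_insert.1 hd with rfl | hd
    · exact ⟨hpm.pow _, by rw [pow_succ', hgc]; exact mul_dvd_mul_left _ (dvd_mul_right _ _)⟩
    · obtain ⟨h2, h3⟩ := (mem_monicDivisors hg.ne_zero).1 hd
      exact ⟨h2, h3.mul_left p⟩
  rw [← Finset.sum_subset hsub]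
  · rw [Finset.sum_insert, ih _ (by omega) hg rfl, polyMangoldt_pow ⟨hpm, hp⟩ (by omega), hdeg]
    · push_cast; ring
    · rw [mem_monicDivisors hg.ne_zero]
      exact fun h => hnd _ (by omega) h.2
  · intro d hd hd'
    by_contra hne
    obtain ⟨r, hr, j, hj, rfl⟩ := exists_pow_of_polyMangoldt_ne_zero hne
    obtain ⟨h2, h3⟩ := (mem_monicDivisors hf.ne_zero).1 hd
    apply hd'
    rw [Finset.mem_insert, mem_monicDivisors hg.ne_zero]
    by_cases hrp : r = p
    · subst hrp
      rcases lt_trichotomy j (v + 1) with h | h | h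
      · exact Or.inr ⟨h2, (pow_dvd_pow r (by omega)).trans (hgc ▸ dvd_mul_right _ _)⟩
      · exact Or.inl (by rw [h])
      · exfalso
        refine hnd (j - 1) (by omega) ?_
        have : r * r ^ (j - 1) ∣ r * g := by
          rwa [← pow_succ', Nat.sub_add_cancel hj]
        exact (mul_dvd_mul_iff_left hp.ne_zero).1 this
    · refine Or.inr ⟨h2, IsCoprime.dvd_of_dvd_mul_left ?_ h3⟩
      refine IsCoprime.pow_left ((hr.2.coprime_iff_not_dvd).2 fun h => hrp ?_)
      exact eq_of_monic_of_associated hr.1 hpm (hr.2.associated_of_dvd hp h)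

theorem conv_polyMangoldt_one {f : F[X]} (hf : f.Monic) :
    conv polyMangoldt (fun _ => 1) f = f.natDegree := by
  rw [conv_const_one _ hf, sum_polyMangoldt_monicDivisors hf]

/-- Vaughan's identity. -/
theorem polyMangoldt_eq_vaughan {u : ℕ} {f : F[X]} (hf : f.Monic) (hu : u < f.natDegree) :
    polyMangoldt f = conv (lowPart u polyMoebius) (fun g => (g.natDegree : ℝ)) f
      - conv (conv (lowPart u polyMoebius) (lowPart u polyMangoldt)) (fun _ => 1) f
      + conv (highPart u polyMangoldt) (conv (highPart u polyMoebius) fun _ => 1) f := by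
  classical
  set one : F[X] → ℝ := fun _ => 1
  set M₁ := lowPart u (polyMoebius (F := F))
  set M₂ := highPart u (polyMoebius (F := F))
  set L₁ := lowPart u (polyMangoldt (F := F))
  set L₂ := highPart u (polyMangoldt (F := F))
  -- Convolve `L₂` with the identity `1 = (M₁ + M₂) * one`. Then rewrite `L₂ * M₁ * one` through `L₂
  -- = Λ - L₁` and `Λ * one = deg`.
  have h0 : polyMangoldt f = L₂ f := by simp [L₂, highPart, hu]
  have h1 : L₂ f = conv L₂ (conv M₁ one) f + conv L₂ (conv M₂ one) f := by
    rw [← conv_add_right, ← conv_ite_eq_one L₂ hf]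
    refine conv_congr (fun _ _ => rfl) (fun g hg => ?_) hf
    rw [← conv_polyMoebius_one hg, ← conv_add_left]
    exact conv_congr (fun g _ => (lowPart_add_highPart u polyMoebius g).symm) (fun _ _ => rfl) hg
  have h2 : conv polyMangoldt (conv M₁ one) f = conv L₁ (conv M₁ one) f + conv L₂ (conv M₁ one) f := by
    rw [← conv_add_left]
    exact conv_congr (fun g _ => (lowPart_add_highPart u polyMangoldt g).symm) (fun _ _ => rfl) hf
  have h3 : conv polyMangoldt (conv M₁ one) f = conv M₁ (fun g => (g.natDegree : ℝ)) f := by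
    rw [← conv_assoc _ _ _ hf, conv_congr (fun g hg => conv_comm polyMangoldt M₁ hg)
      (fun _ _ => rfl) hf, conv_assoc _ _ _ hf]
    exact conv_congr (fun _ _ => rfl) (fun g hg => conv_polyMangoldt_one hg) hf
  have h4 : conv L₁ (conv M₁ one) f = conv (conv M₁ L₁) one f := by
    rw [← conv_assoc _ _ _ hf]
    exact conv_congr (fun g hg => conv_comm _ _ hg) (fun _ _ => rfl) hf
  linarith

/-- The convolution is dominated termwise by `Λ * 1`, which is the degree. -/
theorem abs_conv_low_low_le (u : ℕ) {f : F[X]} (hf : f.Monic) :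
    |conv (lowPart u polyMoebius) (lowPart u polyMangoldt) f| ≤ f.natDegree := by
  rw [← sum_polyMangoldt_monicDivisors hf, ← sum_factorPairs_fst hf]
  rw [conv_comm _ _ hf]
  refine (Finset.abs_sum_le_sum_abs _ _).trans (Finset.sum_le_sum fun p _ => ?_)
  rw [abs_mul, ← mul_one (polyMangoldt p.1)]
  have h1 := polyMangoldt_nonneg p.1
  gcongr
  · exact abs_lowPart_le (abs_of_nonneg h1).le
  · exact abs_lowPart_le (abs_polyMoebius_le _)

theorem abs_conv_high_one_le (u : ℕ) {f : F[X]} (hf : f.Monic) :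
    |conv (highPart u polyMoebius) (fun _ => 1) f| ≤ (monicDivisors f).card := by
  rw [conv_const_one _ hf]
  refine (Finset.abs_sum_le_sum_abs _ _).trans ?_
  rw [Finset.cast_card]
  exact Finset.sum_le_sum fun d _ => abs_highPart_le (abs_polyMoebius_le _)

theorem conv_low_low_eq_zero {u : ℕ} (α β : F[X] → ℝ) {f : F[X]} (hf : f.Monic)
    (h : 2 * u < f.natDegree) : conv (lowPart u α) (lowPart u β) f = 0 := by
  refine Finset.sum_eq_zero fun p hp => ?_
  have := natDegree_add_of_mem_factorPairs hf hp
  rcases le_or_gt p.1.natDegree u with h1 | h1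
  · rw [lowPart, lowPart, if_neg (c := p.2.natDegree ≤ u) (by omega), mul_zero]
  · rw [lowPart, if_neg (by omega), zero_mul]

theorem conv_high_eq_zero {u : ℕ} (α β : F[X] → ℝ) {f : F[X]} (hf : f.Monic)
    (h : f.natDegree ≤ u) : conv (highPart u α) β f = 0 := by
  refine Finset.sum_eq_zero fun p hp => ?_
  have := natDegree_add_of_mem_factorPairs hf hp
  rw [highPart, if_pos (by omega), zero_mul]

theorem sum_monics_conv_mul (n : ℕ) (α β : F[X] → ℝ) (w : F[X] → ℂ) :
    ∑ f ∈ monics F n, (conv α β f : ℂ) * w f = ∑ k ∈ Finset.range (n + 1), ∑ a ∈ monics F k,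
      ∑ b ∈ monics F (n - k), (α a : ℂ) * (β b : ℂ) * w (a * b) := by
  rw [← sum_monics_sum_factorPairs n fun a b => (α a : ℂ) * (β b : ℂ) * w (a * b)]
  refine Finset.sum_congr rfl fun f hf => ?_
  rw [conv]
  push_cast
  rw [Finset.sum_mul]
  refine Finset.sum_congr rfl fun p hp => ?_
  rw [((mem_factorPairs (mem_monics.1 hf).1).1 hp).2.2]

/-- Summing `Λ * 1 = deg` over monics of degree `n` gives a recursion. The sum for `n + 1` minus `q`
times the sum for `n` isolates the top term `(n+1) q^(n+1) - n q^(n+1)`. -/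
theorem sum_monics_polyMangoldt {n : ℕ} (hn : 1 ≤ n) :
    ∑ f ∈ monics F n, polyMangoldt f = (Fintype.card F : ℝ) ^ n := by
  have key : ∀ n : ℕ, ∑ k ∈ Finset.range (n + 1), (∑ a ∈ monics F k, polyMangoldt a) *
      (Fintype.card F : ℝ) ^ (n - k) = n * (Fintype.card F : ℝ) ^ n := by
    intro n
    have h1 : ∑ f ∈ monics F n, conv polyMangoldt (fun _ => 1) f = n * (Fintype.card F : ℝ) ^ n := by
      rw [Finset.sum_congr rfl (g := fun _ => (n : ℝ))]
      · rw [Finset.sum_const, card_monics, nsmul_eq_mul, mul_comm]; push_cast; rfl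
      · intro f hf
        rw [conv_polyMangoldt_one (mem_monics.1 hf).1, (mem_monics.1 hf).2]
    rw [← h1]
    unfold conv
    rw [sum_monics_sum_factorPairs n fun a _ => polyMangoldt a * 1]
    refine Finset.sum_congr rfl fun k _ => ?_
    rw [Finset.sum_mul]
    refine Finset.sum_congr rfl fun a _ => ?_
    rw [Finset.sum_const, card_monics, nsmul_eq_mul, mul_comm, mul_one]; push_cast; rfl
  obtain ⟨n, rfl⟩ : ∃ m, n = m + 1 := ⟨n - 1, by omega⟩
  have h1 := key (n + 1)
  rw [Finset.sum_range_succ, Nat.sub_self, pow_zero, mul_one] at h1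
  have h2 : ∑ k ∈ Finset.range (n + 1), (∑ a ∈ monics F k, polyMangoldt a) *
      (Fintype.card F : ℝ) ^ (n + 1 - k) = Fintype.card F * (n * (Fintype.card F : ℝ) ^ n) := by
    rw [← key n, Finset.mul_sum]
    refine Finset.sum_congr rfl fun k hk => ?_
    rw [Finset.mem_range] at hk
    rw [show n + 1 - k = (n - k) + 1 by omega, pow_succ]
    ring
  rw [h2] at h1
  push_cast at h1
  rw [pow_succ] at h1 ⊢
  linarith

open Classical in
/-- Prime powers with exponent at least two contribute little. -/
theorem norm_sum_polyMangoldt_sub_le {n : ℕ} (hn : 1 ≤ n) (w : F[X] → ℂ) (hw : ∀ f, ‖w f‖ ≤ 1) :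
    ‖∑ f ∈ monics F n, (polyMangoldt f : ℂ) * w f -
      n * ∑ f ∈ monics F n with Irreducible f, w f‖ ≤
      n * ((n + 1) * (Fintype.card F : ℝ) ^ (n / 2)) := by
  have hirr : ∀ f ∈ (monics F n).filter Irreducible, (polyMangoldt f : ℂ) * w f = n * w f := by
    intro f hf
    obtain ⟨h1, h2⟩ := Finset.mem_filter.1 hf
    obtain ⟨h3, h4⟩ := mem_monics.1 h1
    have := polyMangoldt_pow ⟨h3, h2⟩ one_pos
    rw [pow_one] at this
    rw [this, h4]
    simp
  rw [← Finset.sum_filter_add_sum_filter_not _ Irreducible, Finset.sum_congr rfl hirr,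
    ← Finset.mul_sum, add_sub_cancel_left]
  -- `S` contains every proper prime power of degree `n`, since its base has degree at most `n / 2`.
  -- The value `d = 0` only adds the polynomial `1`.
  set S := (Finset.range (n / 2 + 1)).biUnion fun d => (monics F d).image fun p => p ^ (n / d)
  have hS : S.card ≤ (n + 1) * Fintype.card F ^ (n / 2) := by
    refine Finset.card_biUnion_le.trans ((Finset.sum_le_card_nsmul _ _
      (Fintype.card F ^ (n / 2)) fun d hd => ?_).trans ?_)
    · refine Finset.card_image_le.trans ?_
      rw [card_monics]
      rw [Finset.mem_range] at hd
      exact Nat.pow_le_pow_right Fintype.card_pos (by omega)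
    · rw [Finset.card_range, smul_eq_mul]
      gcongr
      omega
  have hsub : ∑ f ∈ monics F n with ¬ Irreducible f, ‖(polyMangoldt f : ℂ) * w f‖ ≤
      ∑ f ∈ S with f ∈ monics F n, ‖(polyMangoldt f : ℂ) * w f‖ := by
    rw [← Finset.sum_filter_ne_zero]
    refine Finset.sum_le_sum_of_subset_of_nonneg ?_ fun _ _ _ => norm_nonneg _
    intro f hf
    obtain ⟨hf, hne⟩ := Finset.mem_filter.1 hf
    obtain ⟨hf, hni⟩ := Finset.mem_filter.1 hf
    refine Finset.mem_filter.2 ⟨?_, hf⟩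
    have h1 : polyMangoldt f ≠ 0 := by
      intro h; simp [h] at hne
    obtain ⟨p, hp, j, hj, rfl⟩ := exists_pow_of_polyMangoldt_ne_zero h1
    have h2 := (mem_monics.1 hf).2
    rw [natDegree_pow] at h2
    have h3 : 2 ≤ j := by
      by_contra h
      have : j = 1 := by omega
      subst this
      rw [pow_one] at hni
      exact hni hp.2
    have hpd := hp.2.natDegree_pos
    refine Finset.mem_biUnion.2 ⟨p.natDegree, Finset.mem_range.2 ?_,
      Finset.mem_image.2 ⟨p, mem_monics.2 ⟨hp.1, rfl⟩, ?_⟩⟩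
    · have : 2 * p.natDegree ≤ n := h2 ▸ Nat.mul_le_mul_right _ h3
      omega
    · rw [← h2, Nat.mul_div_cancel _ hpd]
  refine (norm_sum_le _ _).trans (hsub.trans ?_)
  refine (Finset.sum_le_card_nsmul _ _ (n : ℝ) ?_).trans ?_
  · intro f hf
    have h1 := (mem_monics.1 (Finset.mem_filter.1 hf).2).2
    rw [norm_mul, Complex.norm_real, Real.norm_of_nonneg (polyMangoldt_nonneg f), ← mul_one (n : ℝ)]
    gcongr
    · rw [← h1]; exact polyMangoldt_le f
    · exact hw f
  · rw [nsmul_eq_mul, mul_comm]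
    gcongr
    refine (Nat.cast_le.2 ((Finset.card_filter_le _ _).trans hS)).trans ?_
    push_cast
    exact le_rfl

end ArithmeticFunctions

/-! ### Assembling the bound for sums over irreducible polynomials -/

section Bounds

variable {F : Type*} [Field F] [Fintype F] {ψ : AddChar F ℂ}

theorem norm_bilinear_pow_four_le_of_lt (hψ : ψ ≠ 0) {n u k : ℕ} (hk : u < k) (hkn : u < n - k)
    {α β : F[X] → ℂ}
    (hα : ∑ a ∈ monics F k, ‖α a‖ ^ 2 ≤ ((n : ℝ) + 1) ^ 3 * (Fintype.card F : ℝ) ^ k)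
    (hβ : ∑ b ∈ monics F (n - k), ‖β b‖ ^ 2 ≤ ((n : ℝ) + 1) ^ 3 * (Fintype.card F : ℝ) ^ (n - k)) :
    ‖∑ a ∈ monics F k, ∑ b ∈ monics F (n - k), α a * β b * ψ (rudinShapiro (a * b))‖ ^ 4 ≤
      2 * ((n : ℝ) + 1) ^ 15 * (Fintype.card F : ℝ) ^ (4 * n + 1 - (u + 1) / 2) := by
  have hq : (1 : ℝ) ≤ Fintype.card F := by exact_mod_cast (Fintype.card_pos : 0 < Fintype.card F)
  have key : ∀ {k m : ℕ}, u < k → k ≤ m → k + m = n → ∀ α β : F[X] → ℂ,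
      ∑ a ∈ monics F k, ‖α a‖ ^ 2 ≤ ((n : ℝ) + 1) ^ 3 * (Fintype.card F : ℝ) ^ k →
      ∑ b ∈ monics F m, ‖β b‖ ^ 2 ≤ ((n : ℝ) + 1) ^ 3 * (Fintype.card F : ℝ) ^ m →
      ‖∑ a ∈ monics F k, ∑ b ∈ monics F m, α a * β b * ψ (rudinShapiro (a * b))‖ ^ 4 ≤
      2 * ((n : ℝ) + 1) ^ 15 * (Fintype.card F : ℝ) ^ (4 * n + 1 - (u + 1) / 2) := by
    intro k m hk hkm hn α β hα hβ
    have hm : (m : ℝ) ≤ n := by exact_mod_cast (by omega : m ≤ n)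
    refine (norm_bilinear_rudinShapiro_pow_four_le hψ (by omega) hkm α β).trans ?_
    calc _ ≤ (((n : ℝ) + 1) ^ 3 * (Fintype.card F : ℝ) ^ k) ^ 2 *
          (((n : ℝ) + 1) ^ 3 * (Fintype.card F : ℝ) ^ m) ^ 2 *
          (2 * ((n : ℝ) + 1) ^ 3 * (Fintype.card F : ℝ) ^ (2 * k + 2 * m + 1 - k / 2)) := by
          gcongr
      _ = 2 * ((n : ℝ) + 1) ^ 15 *
          (Fintype.card F : ℝ) ^ (2 * k + 2 * m + (2 * k + 2 * m + 1 - k / 2)) := by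
          rw [pow_add _ (2 * k + 2 * m) (2 * k + 2 * m + 1 - k / 2), pow_add _ (2 * k) (2 * m)]
          ring
      _ ≤ _ := by
          gcongr
          omega
  -- The type II estimate differences in the factor of smaller degree, so the roles of the factors
  -- are swapped when necessary.
  rcases le_total k (n - k) with h | h
  · exact key hk h (by omega) α β hα hβ
  · have := key hkn h (by omega) β α hβ hα
    rw [Finset.sum_comm] at this
    refine le_of_eq_of_le ?_ this
    congr 2
    refine Finset.sum_congr rfl fun a _ => Finset.sum_congr rfl fun b _ => ?_
    rw [mul_comm a b, mul_comm (α a)]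

theorem norm_bilinear_le_of_lt (hψ : ψ ≠ 0) {n k : ℕ} (hn : 1 ≤ n) (hk : (n - 1) / 3 < k)
    (hkn : (n - 1) / 3 < n - k) {α β : F[X] → ℂ}
    (hα : ∑ a ∈ monics F k, ‖α a‖ ^ 2 ≤ ((n : ℝ) + 1) ^ 3 * (Fintype.card F : ℝ) ^ k)
    (hβ : ∑ b ∈ monics F (n - k), ‖β b‖ ^ 2 ≤ ((n : ℝ) + 1) ^ 3 * (Fintype.card F : ℝ) ^ (n - k)) :
    ‖∑ a ∈ monics F k, ∑ b ∈ monics F (n - k), α a * β b * ψ (rudinShapiro (a * b))‖ ≤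
      2 * ((n : ℝ) + 1) ^ 4 * (Fintype.card F : ℝ) ^ (23 / 24 * n + 3 / 8 : ℝ) := by
  have hq : (1 : ℝ) ≤ Fintype.card F := by exact_mod_cast (Fintype.card_pos : 0 < Fintype.card F)
  have hn0 : (0 : ℝ) ≤ n := by positivity
  refine le_of_pow_le_pow_left₀ four_ne_zero (by positivity)
    ((norm_bilinear_pow_four_le_of_lt hψ hk hkn hα hβ).trans ?_)
  rw [mul_pow, mul_pow, ← pow_mul, ← Real.rpow_natCast ((Fintype.card F : ℝ) ^ _) 4,
    ← Real.rpow_mul (by positivity),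
    ← Real.rpow_natCast (Fintype.card F : ℝ) (4 * n + 1 - ((n - 1) / 3 + 1) / 2)]
  have h1 : ((n : ℝ) + 1) ^ 15 ≤ (n + 1) ^ (4 * 4) :=
    pow_le_pow_right₀ (by linarith) (by norm_num)
  -- As `u + 1 ≥ n/3`, the floor of its half is at least `n/6 - 1/2`. The exponent is then at most
  -- `23n/6 + 3/2`, whose quarter is `23n/24 + 3/8`.
  have h2 : 6 * (4 * n + 1 - ((n - 1) / 3 + 1) / 2) ≤ 23 * n + 9 := by omega
  have h3 : (6 * (4 * n + 1 - ((n - 1) / 3 + 1) / 2 : ℕ) : ℝ) ≤ 23 * n + 9 := by exact_mod_cast h2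
  gcongr ?_ * ?_ * ?_
  · norm_num
  · refine Real.rpow_le_rpow_of_exponent_le hq ?_
    push_cast at h3 ⊢
    linarith

/-- Square-root cancellation in `b` and the trivial bound in `a` give the exponent `k + (n+1)/2 ≤
5n/6 + 1/6`, below the type II exponent. -/
theorem norm_linear_le (hψ : ψ ≠ 0) {n k : ℕ} (hn : 1 ≤ n) (hk : k ≤ (n - 1) / 3)
    {c : F[X] → ℂ} (hc : ∀ a ∈ monics F k, ‖c a‖ ≤ n) :
    ‖∑ a ∈ monics F k, ∑ b ∈ monics F (n - k), c a * ψ (rudinShapiro (a * b))‖ ≤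
      2 * ((n : ℝ) + 1) ^ 4 * (Fintype.card F : ℝ) ^ (23 / 24 * n + 3 / 8 : ℝ) := by
  have hq : (1 : ℝ) ≤ Fintype.card F := by exact_mod_cast (Fintype.card_pos : 0 < Fintype.card F)
  have h1 : ∀ a ∈ monics F k, ‖∑ b ∈ monics F (n - k), c a * ψ (rudinShapiro (a * b))‖ ≤
      n * (Fintype.card F : ℝ) ^ ((n + 1 : ℝ) / 2) := by
    intro a ha
    rw [← Finset.mul_sum, norm_mul]
    gcongr
    · exact hc a ha
    · refine le_of_pow_le_pow_left₀ two_ne_zero (by positivity)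
        ((norm_sum_rudinShapiro_mul_sq_le hψ ha (by omega)).trans ?_)
      rw [← Real.rpow_natCast ((Fintype.card F : ℝ) ^ _) 2, ← Real.rpow_mul (by positivity),
        show k + (n - k) + 1 = n + 1 by omega, ← Real.rpow_natCast]
      apply le_of_eq
      congr 1
      push_cast; ring
  refine (norm_sum_le _ _).trans ((Finset.sum_le_card_nsmul _ _ _ h1).trans ?_)
  rw [card_monics, nsmul_eq_mul]
  push_cast
  calc (Fintype.card F : ℝ) ^ k * (n * (Fintype.card F : ℝ) ^ ((n + 1 : ℝ) / 2))
      = n * (Fintype.card F : ℝ) ^ (k + (n + 1 : ℝ) / 2) := by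
        rw [Real.rpow_add (by linarith), Real.rpow_natCast]; ring
    _ ≤ _ := by
        have h2 : (3 * k : ℝ) ≤ n - 1 := by
          rw [le_sub_iff_add_le]; exact_mod_cast (by omega : 3 * k + 1 ≤ n)
        have hn' : (1 : ℝ) ≤ n := by exact_mod_cast hn
        gcongr ?_ * ?_
        · nlinarith [pow_le_pow_right₀ (by linarith : (1 : ℝ) ≤ n + 1) (by norm_num : 1 ≤ 4)]
        · exact Real.rpow_le_rpow_of_exponent_le hq (by linarith)

theorem sum_monics_norm_sq_le {n k : ℕ} {c : F[X] → ℂ} (hc : ∀ a ∈ monics F k, ‖c a‖ ≤ n) :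
    ∑ a ∈ monics F k, ‖c a‖ ^ 2 ≤ ((n : ℝ) + 1) ^ 3 * (Fintype.card F : ℝ) ^ k := by
  refine (Finset.sum_le_card_nsmul _ _ ((n : ℝ) ^ 2) fun a ha => ?_).trans ?_
  · have := hc a ha
    gcongr
  · rw [card_monics, nsmul_eq_mul, mul_comm]
    push_cast
    gcongr
    have : (0 : ℝ) ≤ n := by positivity
    nlinarith [pow_nonneg this 3]

theorem norm_sum_polyMangoldt_mul_le (hψ : ψ ≠ 0) {n : ℕ} (hn : 1 ≤ n) :
    ‖∑ f ∈ monics F n, (polyMangoldt f : ℂ) * ψ (rudinShapiro f)‖ ≤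
      6 * ((n : ℝ) + 1) ^ 5 * (Fintype.card F : ℝ) ^ (23 / 24 * n + 3 / 8 : ℝ) := by
  set u := (n - 1) / 3 with hu
  set X : ℝ := (Fintype.card F : ℝ) ^ (23 / 24 * n + 3 / 8 : ℝ)
  have hX : 0 ≤ X := by positivity
  have hn0 : (0 : ℝ) ≤ n := by positivity
  have hvaughan : ∀ f ∈ monics F n, (polyMangoldt f : ℂ) * ψ (rudinShapiro f) =
      (conv (lowPart u polyMoebius) (fun g => (g.natDegree : ℝ)) f : ℂ) * ψ (rudinShapiro f)
      - (conv (conv (lowPart u polyMoebius) (lowPart u polyMangoldt)) (fun _ => 1) f : ℂ)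
        * ψ (rudinShapiro f)
      + (conv (highPart u polyMangoldt) (conv (highPart u polyMoebius) fun _ => 1) f : ℂ)
        * ψ (rudinShapiro f) := by
    intro f hf
    obtain ⟨h1, h2⟩ := mem_monics.1 hf
    rw [polyMangoldt_eq_vaughan h1 (u := u) (by omega)]
    push_cast; ring
  have hbound : ∀ α β : F[X] → ℝ, (∀ k ≤ n, ‖∑ a ∈ monics F k, ∑ b ∈ monics F (n - k),
      (α a : ℂ) * (β b : ℂ) * ψ (rudinShapiro (a * b))‖ ≤ 2 * ((n : ℝ) + 1) ^ 4 * X) →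
      ‖∑ f ∈ monics F n, (conv α β f : ℂ) * ψ (rudinShapiro f)‖ ≤ 2 * ((n : ℝ) + 1) ^ 5 * X := by
    intro α β h
    rw [sum_monics_conv_mul n α β fun f => ψ (rudinShapiro f)]
    refine (norm_sum_le _ _).trans ((Finset.sum_le_card_nsmul _ _ _ fun k hk =>
      h k (by simpa [Nat.lt_succ_iff] using hk)).trans (le_of_eq ?_))
    rw [Finset.card_range, nsmul_eq_mul]
    push_cast; ring
  rw [Finset.sum_congr rfl hvaughan, Finset.sum_add_distrib, Finset.sum_sub_distrib]
  have hY : (0 : ℝ) ≤ 2 * ((n : ℝ) + 1) ^ 4 * X := by positivity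
  -- Only degrees `k ≤ u` occur. The weight `deg b = n - k` is constant, so this is a type I sum.
  have t1 := hbound (lowPart u polyMoebius) (fun g => (g.natDegree : ℝ)) (by
    intro k hk
    by_cases hku : k ≤ u
    · refine le_of_eq_of_le ?_ (norm_linear_le hψ hn hku
        (c := fun a => (lowPart u polyMoebius a : ℂ) * ((n - k : ℕ) : ℂ)) ?_)
      · congr 1
        refine Finset.sum_congr rfl fun a _ => Finset.sum_congr rfl fun b hb => ?_
        rw [(mem_monics.1 hb).2]
        push_cast; rfl
      · intro a _
        rw [norm_mul, Complex.norm_real, Real.norm_eq_abs, Complex.norm_natCast,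
          ← one_mul (n : ℝ)]
        gcongr
        · exact abs_lowPart_le (abs_polyMoebius_le a)
        · exact Nat.sub_le n k
    · refine le_of_eq_of_le ?_ hY
      rw [norm_eq_zero]
      refine Finset.sum_eq_zero fun a ha => Finset.sum_eq_zero fun b _ => ?_
      rw [lowPart, if_neg (by rwa [(mem_monics.1 ha).2])]
      simp)
  -- The coefficient lives on degrees at most `2 * u`. For `k ≤ u` the sum is of type I. For `u < k
  -- ≤ 2u` it is of type II, since `3u < n` gives `n - k > u`.
  have t2 := hbound (conv (lowPart u polyMoebius) (lowPart u polyMangoldt)) (fun _ => 1) (by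
    intro k hk
    have hc : ∀ a ∈ monics F k,
        ‖(conv (lowPart u polyMoebius) (lowPart u polyMangoldt) a : ℂ)‖ ≤ n := by
      intro a ha
      obtain ⟨h1, h2⟩ := mem_monics.1 ha
      rw [Complex.norm_real, Real.norm_eq_abs]
      refine (abs_conv_low_low_le u h1).trans ?_
      rw [h2]
      exact_mod_cast hk
    by_cases hku : k ≤ u
    · refine le_of_eq_of_le ?_ (norm_linear_le hψ hn hku hc)
      simp
    by_cases hku2 : k ≤ 2 * u
    · refine norm_bilinear_le_of_lt hψ hn (by omega) (by omega) (sum_monics_norm_sq_le hc)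
        (sum_monics_norm_sq_le fun _ _ => ?_)
      simpa using hn
    · refine le_of_eq_of_le ?_ hY
      rw [norm_eq_zero]
      refine Finset.sum_eq_zero fun a ha => Finset.sum_eq_zero fun b _ => ?_
      obtain ⟨h1, h2⟩ := mem_monics.1 ha
      rw [conv_low_low_eq_zero _ _ h1 (by omega)]
      simp)
  -- Both factors vanish on degrees up to `u`, so only type II sums remain. The second weight is
  -- bounded by the divisor function and needs its second moment.
  have t3 := hbound (highPart u polyMangoldt) (conv (highPart u polyMoebius) fun _ => 1) (by
    intro k hk
    by_cases hku : k ≤ u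
    · refine le_of_eq_of_le ?_ hY
      rw [norm_eq_zero]
      refine Finset.sum_eq_zero fun a ha => Finset.sum_eq_zero fun b _ => ?_
      rw [highPart, if_pos (by rwa [(mem_monics.1 ha).2])]
      simp
    by_cases hnku : n - k ≤ u
    · refine le_of_eq_of_le ?_ hY
      rw [norm_eq_zero]
      refine Finset.sum_eq_zero fun a ha => Finset.sum_eq_zero fun b hb => ?_
      obtain ⟨h1, h2⟩ := mem_monics.1 hb
      rw [conv_high_eq_zero _ _ h1 (by omega)]
      simp
    · refine norm_bilinear_le_of_lt hψ hn (by omega) (by omega) (sum_monics_norm_sq_le ?_) ?_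
      · intro a ha
        rw [Complex.norm_real, Real.norm_eq_abs]
        refine abs_highPart_le ?_
        rw [abs_of_nonneg (polyMangoldt_nonneg a)]
        refine (polyMangoldt_le a).trans ?_
        rw [(mem_monics.1 ha).2]
        exact_mod_cast hk
      · have h1 : ((∑ b ∈ monics F (n - k), (monicDivisors b).card ^ 2 : ℕ) : ℝ) ≤
            (((n - k) + 1) ^ 3 * Fintype.card F ^ (n - k) : ℕ) :=
          Nat.cast_le.2 (sum_card_monicDivisors_sq_le (n - k))
        push_cast at h1
        refine (Finset.sum_le_sum fun b hb => ?_).trans (h1.trans ?_)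
        · rw [Complex.norm_real, Real.norm_eq_abs]
          gcongr
          exact abs_conv_high_one_le u (mem_monics.1 hb).1
        · gcongr
          exact Nat.sub_le n k)
  refine (norm_add_le _ _).trans ((add_le_add_left (norm_sub_le _ _) _).trans ?_)
  linarith

open Classical in
theorem norm_sum_irreducible_le (hψ : ψ ≠ 0) {n : ℕ} (hn : 1 ≤ n) :
    ‖∑ f ∈ monics F n with Irreducible f, ψ (rudinShapiro f)‖ ≤
      7 * ((n : ℝ) + 1) ^ 5 * (Fintype.card F : ℝ) ^ (23 / 24 * n + 3 / 8 : ℝ) := by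
  have hq : (1 : ℝ) ≤ Fintype.card F := by exact_mod_cast (Fintype.card_pos : 0 < Fintype.card F)
  have hn' : (1 : ℝ) ≤ n := by exact_mod_cast hn
  have h1 := norm_sum_polyMangoldt_sub_le hn (fun f : F[X] => ψ (rudinShapiro f))
    (fun f => (AddChar.norm_apply ψ _).le)
  have h2 := norm_sum_polyMangoldt_mul_le hψ hn
  set A := ∑ f ∈ monics F n, (polyMangoldt f : ℂ) * ψ (rudinShapiro f)
  set S := ∑ f ∈ monics F n with Irreducible f, ψ (rudinShapiro f)
  have h3 : n * ‖S‖ ≤ ‖A‖ + ‖A - n * S‖ := by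
    rw [← Complex.norm_natCast, ← norm_mul]
    calc ‖(n : ℂ) * S‖ = ‖A - (A - n * S)‖ := by congr 1; ring
      _ ≤ _ := norm_sub_le _ _
  have h4 : n * ((n + 1) * (Fintype.card F : ℝ) ^ (n / 2)) ≤
      ((n : ℝ) + 1) ^ 5 * (Fintype.card F : ℝ) ^ (23 / 24 * n + 3 / 8 : ℝ) := by
    rw [← mul_assoc, ← Real.rpow_natCast]
    have h5 : ((n / 2 : ℕ) : ℝ) ≤ n / 2 := Nat.cast_div_le
    gcongr ?_ * ?_
    · nlinarith [pow_le_pow_right₀ (by linarith : (1 : ℝ) ≤ n + 1) (by norm_num : 2 ≤ 5)]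
    · exact Real.rpow_le_rpow_of_exponent_le hq (by linarith)
  have h6 : ‖S‖ ≤ n * ‖S‖ := le_mul_of_one_le_left (norm_nonneg _) hn'
  linarith

open Classical in
-- Detect `R x = γ` by averaging over all additive characters. The trivial one gives the main term,
-- and the others are fewer than `q`.
theorem abs_card_filter_eq_sub_le {ι : Type*} (s : Finset ι) (R : ι → F) (γ : F) {B : ℝ}
    (h : ∀ ψ : AddChar F ℂ, ψ ≠ 0 → ‖∑ x ∈ s, ψ (R x)‖ ≤ B) :
    |((s.filter fun x => R x = γ).card : ℝ) - (s.card : ℝ) / Fintype.card F| ≤ B := by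
  have hq : (0 : ℝ) < Fintype.card F := by exact_mod_cast (Fintype.card_pos : 0 < Fintype.card F)
  have h1 : ∑ ψ : AddChar F ℂ, ψ (-γ) * ∑ x ∈ s, ψ (R x) =
      (Fintype.card F : ℂ) * (s.filter fun x => R x = γ).card := by
    simp only [Finset.mul_sum]
    rw [Finset.sum_comm]
    simp only [← AddChar.map_add_eq_mul, AddChar.sum_apply_eq_ite, neg_add_eq_zero, eq_comm (a := γ)]
    rw [← Finset.sum_filter, Finset.sum_const, nsmul_eq_mul, mul_comm]
  have hB : 0 ≤ B ∨ Fintype.card F ≤ 1 := by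
    rw [or_iff_not_imp_right]
    intro hc
    have : Nontrivial (AddChar F ℂ) := by
      rw [← Fintype.one_lt_card_iff_nontrivial, AddChar.card_eq]
      omega
    obtain ⟨ψ, hψ⟩ := exists_ne (0 : AddChar F ℂ)
    exact (norm_nonneg _).trans (h ψ hψ)
  replace hB : 0 ≤ B := hB.resolve_right (by have := Fintype.one_lt_card (α := F); omega)
  rw [← Finset.add_sum_erase _ _ (Finset.mem_univ (0 : AddChar F ℂ))] at h1
  simp only [AddChar.zero_apply, one_mul, Finset.sum_const, nsmul_eq_mul, mul_one] at h1
  have h2 : ‖(Fintype.card F : ℂ) * (s.filter fun x => R x = γ).card - s.card‖ ≤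
      Fintype.card F * B := by
    rw [← h1, add_sub_cancel_left]
    refine (norm_sum_le _ _).trans ((Finset.sum_le_card_nsmul _ _ B ?_).trans ?_)
    · intro ψ hψ
      rw [norm_mul, AddChar.norm_apply, one_mul]
      exact h ψ (Finset.ne_of_mem_erase hψ)
    · rw [nsmul_eq_mul]
      gcongr
      rw [← AddChar.card_eq (α := F)]
      exact Finset.card_le_univ _
  have h3 : ‖(Fintype.card F : ℂ) * (s.filter fun x => R x = γ).card - s.card‖ =
      |(Fintype.card F : ℝ) * (s.filter fun x => R x = γ).card - s.card| := by
    rw [← Real.norm_eq_abs, ← Complex.norm_real]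
    push_cast; rfl
  rw [h3] at h2
  rw [show ((s.filter fun x => R x = γ).card : ℝ) - (s.card : ℝ) / Fintype.card F =
    ((Fintype.card F : ℝ) * (s.filter fun x => R x = γ).card - s.card) / Fintype.card F by
      field_simp, abs_div, abs_of_pos hq, div_le_iff₀ hq]
  linarith

open Classical in
theorem ncard_monicIrreducibles (n : ℕ) :
    (monicIrreducibles F n).ncard = ((monics F n).filter Irreducible).card := by
  rw [← Set.ncard_coe_finset]
  congr 1
  ext f
  simp only [monicIrreducibles, Finset.coe_filter, mem_monics, Set.mem_ofPred_eq]
  tauto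

open Classical in
theorem ncard_rudinShapiroFiber (n : ℕ) (γ : F) : (rudinShapiroFiber n γ).ncard =
    (((monics F n).filter Irreducible).filter fun f => rudinShapiro f = γ).card := by
  rw [← Set.ncard_coe_finset]
  congr 1
  ext f
  simp only [rudinShapiroFiber, monicIrreducibles, Finset.coe_filter, Finset.mem_filter, mem_monics,
    Set.mem_ofPred_eq]
  tauto

theorem abs_ncard_rudinShapiroFiber_sub_le (γ : F) {n : ℕ} (hn : 1 ≤ n) :
    |((rudinShapiroFiber n γ).ncard : ℝ) -
      ((monicIrreducibles F n).ncard : ℝ) / (Fintype.card F : ℝ)| ≤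
      7 * ((n : ℝ) + 1) ^ 5 * (Fintype.card F : ℝ) ^ (23 / 24 * n + 3 / 8 : ℝ) := by
  classical
  rw [ncard_rudinShapiroFiber, ncard_monicIrreducibles]
  exact abs_card_filter_eq_sub_le _ _ _ fun ψ hψ => norm_sum_irreducible_le hψ hn

theorem le_ncard_monicIrreducibles {n : ℕ} (hn : 1 ≤ n) :
    (Fintype.card F : ℝ) ^ n - n * ((n + 1) * (Fintype.card F : ℝ) ^ (n / 2)) ≤
      n * ((monicIrreducibles F n).ncard : ℝ) := by
  classical
  have h1 := norm_sum_polyMangoldt_sub_le hn (fun _ : F[X] => (1 : ℂ)) (by simp)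
  rw [ncard_monicIrreducibles]
  simp only [mul_one, Finset.sum_const, nsmul_eq_mul] at h1
  rw [← Complex.ofReal_sum, sum_monics_polyMangoldt hn] at h1
  have h2 : ‖(((Fintype.card F : ℝ) ^ n : ℝ) : ℂ) - n * ((monics F n).filter Irreducible).card‖ =
      |(Fintype.card F : ℝ) ^ n - n * ((monics F n).filter Irreducible).card| := by
    rw [← Real.norm_eq_abs, ← Complex.norm_real]
    push_cast; rfl
  rw [h2] at h1
  have := (abs_le.1 h1).2
  linarith

end Bounds

/-! ### Absorbing powers of `n` into exponentials, and the final asymptotics -/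

theorem exists_pow_le_mul_pow (k : ℕ) {b : ℝ} (hb : 1 < b) :
    ∃ C : ℝ, 0 < C ∧ ∀ n : ℕ, ((n : ℝ) + 1) ^ k ≤ C * b ^ n := by
  obtain ⟨M, hM⟩ := (tendsto_pow_const_div_const_pow_of_one_lt k hb).bddAbove_range
  have hb0 : 0 < b := by linarith
  refine ⟨max M 1 * b, by positivity, fun n => ?_⟩
  have h1 : ((n + 1 : ℕ) : ℝ) ^ k / b ^ (n + 1) ≤ max M 1 :=
    (hM (Set.mem_range_self (n + 1))).trans (le_max_left _ _)
  rw [div_le_iff₀ (by positivity), pow_succ'] at h1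
  push_cast at h1
  linarith

theorem two_mul_mul_succ_le_two_pow {m : ℕ} (hm : 29 ≤ m) : 2 * (2 * m) * (2 * m + 1) ≤ 2 ^ m := by
  induction m, hm using Nat.le_induction with
  | base => norm_num
  | succ m hm ih =>
    rw [pow_succ]
    nlinarith

theorem pow_div_le_ncard_monicIrreducibles {F : Type*} [Field F] [Fintype F] {n : ℕ} (hn : 57 ≤ n) :
    (Fintype.card F : ℝ) ^ n / (2 * n) ≤ ((monicIrreducibles F n).ncard : ℝ) := by
  have hq : 2 ≤ Fintype.card F := Fintype.one_lt_card
  have h1 : 2 * (n * (n + 1)) ≤ Fintype.card F ^ (n - n / 2) := by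
    refine le_trans ?_ ((two_mul_mul_succ_le_two_pow (m := n - n / 2) (by omega)).trans
      (Nat.pow_le_pow_left hq _))
    rw [← mul_assoc]
    gcongr <;> omega
  have h2 : 2 * (n * (n + 1)) * Fintype.card F ^ (n / 2) ≤ Fintype.card F ^ n := by
    calc _ ≤ Fintype.card F ^ (n - n / 2) * Fintype.card F ^ (n / 2) := by gcongr
      _ = _ := by rw [← pow_add]; congr 1; omega
  have h3 : 2 * ((n : ℝ) * (n + 1)) * (Fintype.card F : ℝ) ^ (n / 2) ≤ (Fintype.card F : ℝ) ^ n := by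
    exact_mod_cast h2
  have h4 := le_ncard_monicIrreducibles (F := F) (n := n) (by omega)
  have hn0 : (0 : ℝ) < n := by exact_mod_cast (by omega : 0 < n)
  rw [div_le_iff₀ (by positivity)]
  linarith

/-- The arithmetic is `23/24 + 1/168 = 27/28`: the spare `q^(n/168) ≥ 2^(n/168)` absorbs `(n+1)^5`.
-/
theorem exists_const_error_le : ∃ C : ℝ, 0 < C ∧ ∀ (q : ℝ) (n : ℕ), 2 ≤ q → 1 ≤ n →
    7 * ((n : ℝ) + 1) ^ 5 * q ^ (23 / 24 * n + 3 / 8 : ℝ) ≤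
      C * ((n : ℝ) ^ (3 / 2 : ℝ) * q ^ ((1 - 1 / 28 : ℝ) * (n : ℝ) + 1)) := by
  obtain ⟨C, hC, h⟩ := exists_pow_le_mul_pow 5
    (Real.one_lt_rpow (by norm_num : (1 : ℝ) < 2) (by norm_num : (0 : ℝ) < 1 / 168))
  refine ⟨7 * C, by positivity, fun q n hq hn => ?_⟩
  have hn' : (1 : ℝ) ≤ n := by exact_mod_cast hn
  have h1 : ((2 : ℝ) ^ (1 / 168 : ℝ)) ^ n ≤ q ^ (1 / 168 * n : ℝ) := by
    rw [← Real.rpow_natCast, ← Real.rpow_mul (by norm_num)]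
    exact Real.rpow_le_rpow (by norm_num) hq (by positivity)
  calc 7 * ((n : ℝ) + 1) ^ 5 * q ^ (23 / 24 * n + 3 / 8 : ℝ)
      ≤ 7 * (C * q ^ (1 / 168 * n : ℝ)) * q ^ (23 / 24 * n + 3 / 8 : ℝ) := by
        gcongr
        exact (h n).trans (by gcongr)
    _ = 7 * C * (1 * q ^ (1 / 168 * n + (23 / 24 * n + 3 / 8) : ℝ)) := by
        rw [Real.rpow_add (by linarith) (1 / 168 * n : ℝ)]; ring
    _ ≤ _ := by
        gcongr 7 * C * (?_ * ?_)
        · exact Real.one_le_rpow hn' (by norm_num)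
        · exact Real.rpow_le_rpow_of_exponent_le (by linarith) (by linarith)

theorem exists_threshold_error_le {ε : ℝ} (hε : 0 < ε) : ∃ N : ℕ, ∀ q n : ℕ, 2 ≤ q → 57 ≤ n →
    (N ≤ n ∨ N ≤ q) → 7 * ((n : ℝ) + 1) ^ 5 * (q : ℝ) ^ (23 / 24 * n + 3 / 8 : ℝ) ≤
      ε * ((q : ℝ) ^ n / (2 * n) / q) := by
  -- The error relative to `q^n / (2nq)` is at most `14 (n+1)^6 q^(11/8 - n/24)`. Of the saving
  -- `q^(n/24 - 11/8)`, a factor `q^(1/2)` is kept for growth in `q`, and the rest dominates `b^n *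
  -- b^n / 4`. One `b^n` absorbs `(n+1)^6` and the other gives growth in `n`.
  set b : ℝ := (2 : ℝ) ^ (1 / 48 : ℝ) with hb_def
  have hb : 1 < b := Real.one_lt_rpow (by norm_num) (by norm_num)
  obtain ⟨C, hC, h⟩ := exists_pow_le_mul_pow 6 hb
  obtain ⟨N₁, hN₁⟩ := pow_unbounded_of_one_lt (56 * C / ε) hb
  refine ⟨max N₁ ⌈(56 * C / ε) ^ 2⌉₊, fun q n hq hn hN => ?_⟩
  have hq2 : (2 : ℝ) ≤ q := by exact_mod_cast hq
  have hq0 : (0 : ℝ) < q := by linarith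
  have hn57 : (57 : ℝ) ≤ n := by exact_mod_cast hn
  have hlarge : 56 * C / ε ≤ (q : ℝ) ^ (1 / 2 : ℝ) * b ^ n := by
    have h1 : 1 ≤ b ^ n := one_le_pow₀ hb.le
    have h2 : 1 ≤ (q : ℝ) ^ (1 / 2 : ℝ) := Real.one_le_rpow (by linarith) (by norm_num)
    rcases hN with hN | hN
    · have h3 : b ^ N₁ ≤ b ^ n := pow_le_pow_right₀ hb.le ((le_max_left _ _).trans hN)
      calc 56 * C / ε ≤ 1 * b ^ n := by linarith
        _ ≤ _ := by gcongr
    · have h3 : (56 * C / ε) ^ 2 ≤ q :=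
        (Nat.le_ceil _).trans (by exact_mod_cast (le_max_right _ _).trans hN)
      have h4 : 56 * C / ε ≤ (q : ℝ) ^ (1 / 2 : ℝ) := by
        rw [← Real.sqrt_eq_rpow]
        exact Real.le_sqrt_of_sq_le h3
      calc 56 * C / ε ≤ (q : ℝ) ^ (1 / 2 : ℝ) * 1 := by linarith
        _ ≤ _ := by gcongr
  rw [div_le_iff₀ hε] at hlarge
  -- Passing from base `2` to base `q` needs a nonnegative exponent `n/24 - 15/8`, which holds for
  -- `n ≥ 57`. The factor `4 = 2^2` covers the `15/8`.
  have hbn : b ^ n * b ^ n ≤ 4 * (q : ℝ) ^ (1 / 24 * n - 15 / 8 : ℝ) := by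
    rw [← mul_pow, hb_def, ← Real.rpow_add (by norm_num), ← Real.rpow_natCast,
      ← Real.rpow_mul (by norm_num)]
    calc (2 : ℝ) ^ ((1 / 48 + 1 / 48) * n : ℝ) ≤ (2 : ℝ) ^ (2 + (1 / 24 * n - 15 / 8) : ℝ) :=
          Real.rpow_le_rpow_of_exponent_le (by norm_num) (by linarith)
      _ = 4 * (2 : ℝ) ^ (1 / 24 * n - 15 / 8 : ℝ) := by
          rw [Real.rpow_add (by norm_num)]; norm_num
      _ ≤ _ := mul_le_mul_of_nonneg_left
          (Real.rpow_le_rpow (by norm_num) hq2 (by linarith)) (by norm_num)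
  have hmain : 14 * ((n : ℝ) + 1) ^ 6 ≤ ε * (q : ℝ) ^ (1 / 24 * n - 11 / 8 : ℝ) := by
    have h1 : (q : ℝ) ^ (1 / 24 * n - 11 / 8 : ℝ) =
        (q : ℝ) ^ (1 / 2 : ℝ) * (q : ℝ) ^ (1 / 24 * n - 15 / 8 : ℝ) := by
      rw [← Real.rpow_add hq0]; congr 1; ring
    have hb0 : 0 < b ^ n := by positivity
    calc 14 * ((n : ℝ) + 1) ^ 6 ≤ 14 * (C * b ^ n) := by gcongr; exact h n
      _ = (56 * C) * b ^ n / 4 := by ring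
      _ ≤ ((q : ℝ) ^ (1 / 2 : ℝ) * b ^ n * ε) * b ^ n / 4 := by gcongr
      _ = ε * (q : ℝ) ^ (1 / 2 : ℝ) * (b ^ n * b ^ n) / 4 := by ring
      _ ≤ ε * (q : ℝ) ^ (1 / 2 : ℝ) * (4 * (q : ℝ) ^ (1 / 24 * n - 15 / 8 : ℝ)) / 4 := by gcongr
      _ = _ := by rw [h1]; ring
  rw [← mul_div_assoc, ← mul_div_assoc, le_div_iff₀ hq0, le_div_iff₀ (by positivity)]
  calc 7 * ((n : ℝ) + 1) ^ 5 * (q : ℝ) ^ (23 / 24 * n + 3 / 8 : ℝ) * q * (2 * n)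
      = (14 * (((n : ℝ) + 1) ^ 5 * n)) * (q : ℝ) ^ (23 / 24 * n + 11 / 8 : ℝ) := by
        rw [show (23 / 24 * n + 11 / 8 : ℝ) = 23 / 24 * n + 3 / 8 + 1 by ring,
          Real.rpow_add hq0 _ 1, Real.rpow_one]
        ring
    _ ≤ (14 * ((n : ℝ) + 1) ^ 6) * (q : ℝ) ^ (23 / 24 * n + 11 / 8 : ℝ) := by
        rw [pow_succ _ 5]
        gcongr
        linarith
    _ ≤ ε * (q : ℝ) ^ (1 / 24 * n - 11 / 8 : ℝ) * (q : ℝ) ^ (23 / 24 * n + 11 / 8 : ℝ) := by gcongr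
    _ = ε * (q : ℝ) ^ n := by
        rw [mul_assoc, ← Real.rpow_add hq0, ← Real.rpow_natCast]
        congr 2; ring

/-- First part: the bound with `δ = 1/28` and an absolute constant `C`. Second part: the
counts are asymptotic to `#P(n)/q`, uniformly in `γ`, as `n → ∞` or as `q → ∞` with
`n > 2/δ = 56`. -/
theorem theorem1 :
    (∃ C : ℝ, 0 < C ∧
      ∀ (F : Type u) [Field F] [Fintype F], Odd (Fintype.card F) →
        ∀ (γ : F) (n : ℕ), 3 ≤ n →
          |((rudinShapiroFiber n γ).ncard : ℝ)
              - ((monicIrreducibles F n).ncard : ℝ) / (Fintype.card F : ℝ)|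
            ≤ C * ((n : ℝ) ^ (3 / 2 : ℝ)
                * (Fintype.card F : ℝ) ^ ((1 - 1 / 28 : ℝ) * (n : ℝ) + 1))) ∧
    (∀ ε : ℝ, 0 < ε → ∃ N : ℕ,
      ∀ (F : Type u) [Field F] [Fintype F], Odd (Fintype.card F) →
        ∀ (γ : F) (n : ℕ), 56 < n → (N ≤ n ∨ N ≤ Fintype.card F) →
          |((rudinShapiroFiber n γ).ncard : ℝ)
              - ((monicIrreducibles F n).ncard : ℝ) / (Fintype.card F : ℝ)|
            ≤ ε * (((monicIrreducibles F n).ncard : ℝ) / (Fintype.card F : ℝ))) := by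
  constructor
  · obtain ⟨C, hC, h⟩ := exists_const_error_le
    refine ⟨C, hC, fun F _ _ _ γ n hn => ?_⟩
    exact (abs_ncard_rudinShapiroFiber_sub_le γ (by omega)).trans
      (h _ n (by exact_mod_cast Fintype.one_lt_card) (by omega))
  · intro ε hε
    obtain ⟨N, h⟩ := exists_threshold_error_le hε
    refine ⟨N, fun F _ _ _ γ n hn hN => ?_⟩
    refine (abs_ncard_rudinShapiroFiber_sub_le γ (by omega)).trans
      ((h _ n Fintype.one_lt_card hn hN).trans ?_)
    gcongr
    exact pow_div_le_ncard_monicIrreducibles hn
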